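/- Let $d\ge 0$ be an integer, let $\langle z,w\rangle=\sum_{i=1}^d z_i\overline{w_i}$ and $|z|^2=\langle z,z\rangle$ on $\mathbb C^d$, and let $\mathcal F^2$ be the Fock space of all entire functions $f$ on $\mathbb C^d$ with $\|f\|^2=\pi^{-d}\int_{\mathbb C^d}|f(z)|^2e^{-|z|^2}\,dV(z)<\infty$, a Hilbert space with inner product $\langle f,g\rangle=\pi^{-d}\int_{\mathbb C^d} f(z)\overline{g(z)}e^{-|z|^2}\,dV(z)$ and kernel functions $K_w(u)=e^{\langle u,w\rangle}$, $w\in\mathbb C^d$. Let $A$ be a complex $d\times d$ matrix, $b\in\mathbb C^d$ and $c\in\mathbb C$ such that the formula $$(\mathcal C f)(z)=c\,e^{\langle z,\overline b\rangle}\,\overline{f\left(\overline{Az+b}\right)}$$ defines a conjugation $\mathcal C$ on $\mathcal F^2$, i.e. an antilinear, isometric and involutive map $\mathcal F^2\to\mathcal F^2$. A closed, densely defined linear operator $S$ on $\mathcal F^2$ is called $\mathcal C$-symmetric if $S\preceq\mathcal C S^*\mathcal C$ (inclusion of graphs), and $\mathcal C$-selfadjoint if $S=\mathcal C S^*\mathcal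 C$ (with equal domains), where $\operatorname{dom}(\mathcal C S^*\mathcal C)=\{f:\mathcal C f\in\operatorname{dom}(S^*)\}$. Let $\psi$ be an entire function on $\mathbb C^d$ that is not identically zero and let $\varphi:\mathbb C^d\to\mathbb C^d$ be holomorphic. Let $C_{\psi,\varphi,\max}$ be the operator $f\mapsto\psi\cdot(f\circ\varphi)$ with domain $\{f\in\mathcal F^2:\psi\cdot(f\circ\varphi)\in\mathcal F^2\}$, and suppose that this domain contains $K_w$ for every $w\in\mathbb C^d$. Then the following are equivalent: (i) $C_{\psi,\varphi,\max}$ is $\mathcal C$-selfadjoint; (ii) $C_{\psi,\varphi,\max}$ is $\mathcal C$-symmetric; (iii) there are $\theta\in\mathbb C$, $q\in\mathbb C^d$ and a complex $d\times d$ matrix $Q$ with $(AQ)^{\mathbf t}=AQ$ such that, for all $z\in\mathbb C^d$, $$\psi(z)=\theta e^{\langle z,\ell\rangle},\qquad \varphi(z)=Qz+q,\qquad\text{where } \ell=\overline{Aq}+\overline b-Q^*\overline b .$$ -/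

import Mathlib

open MeasureTheory Filter Topology ComplexConjugate

noncomputable section

namespace Fock

/-- The Hermitian product `⟨z, w⟩ = ∑ zᵢ conj wᵢ` of `ℂᵈ`, linear in the first variable. -/
def herm {d : ℕ} (z w : Fin d → ℂ) : ℂ := ∑ i, z i * conj (w i)

/-- The square `|z|² = ∑ |zᵢ|²` of the Euclidean norm of `ℂᵈ`. -/
def sqNorm {d : ℕ} (z : Fin d → ℂ) : ℝ := ∑ i, ‖z i‖ ^ 2

lemma continuous_sqNorm (d : ℕ) : Continuous (sqNorm (d := d)) := by
  unfold sqNorm; fun_prop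

lemma sqNorm_nonneg {d : ℕ} (z : Fin d → ℂ) : 0 ≤ sqNorm z := by
  unfold sqNorm; positivity

/-- The density `π⁻ᵈ exp (-|z|²)` of the Gaussian measure with respect to Lebesgue measure. -/
def weight {d : ℕ} (z : Fin d → ℂ) : ℝ := (1 / Real.pi ^ d) * Real.exp (-sqNorm z)

lemma continuous_weight (d : ℕ) : Continuous (weight (d := d)) := by
  have := continuous_sqNorm d
  unfold weight; fun_prop

lemma weight_pos {d : ℕ} (z : Fin d → ℂ) : 0 < weight z := by
  unfold weight; positivity

/-- `f √weight`, which is in `L²` of Lebesgue measure exactly when `f` is square integrable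
against the Gaussian measure. -/
def weighted {d : ℕ} (f : (Fin d → ℂ) → ℂ) (z : Fin d → ℂ) : ℂ := (√(weight z) : ℝ) * f z

lemma continuous_weighted {d : ℕ} {f : (Fin d → ℂ) → ℂ} (hf : Continuous f) :
    Continuous (weighted f) := by
  have := continuous_weight d
  unfold weighted; fun_prop

lemma norm_weighted_sq {d : ℕ} (f : (Fin d → ℂ) → ℂ) (z : Fin d → ℂ) :
    ‖weighted f z‖ ^ 2 = ‖f z‖ ^ 2 * weight z := by
  unfold weighted
  rw [norm_mul, mul_pow, Complex.norm_real, Real.norm_eq_abs, sq_abs,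
    Real.sq_sqrt (weight_pos z).le, mul_comm]

lemma memLp_weighted_iff {d : ℕ} {f : (Fin d → ℂ) → ℂ} (hf : Continuous f) :
    MemLp (weighted f) 2 volume ↔ Integrable (fun z => ‖f z‖ ^ 2 * weight z) := by
  rw [memLp_two_iff_integrable_sq_norm (continuous_weighted hf).aestronglyMeasurable]
  simp only [norm_weighted_sq]

/-- The entire functions on `ℂᵈ` with `π⁻ᵈ ∫ |f(z)|² exp (-|z|²) dV(z) < ∞`. -/
def fockSubmodule (d : ℕ) : Submodule ℂ ((Fin d → ℂ) → ℂ) where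
  carrier := {f | Differentiable ℂ f ∧ Integrable (fun z => ‖f z‖ ^ 2 * weight z)}
  zero_mem' := ⟨differentiable_const _, by simp⟩
  add_mem' := by
    rintro f g ⟨hf, hf2⟩ ⟨hg, hg2⟩
    refine ⟨hf.add hg, ?_⟩
    rw [← memLp_weighted_iff hf.continuous] at hf2
    rw [← memLp_weighted_iff hg.continuous] at hg2
    rw [← memLp_weighted_iff (hf.add hg).continuous]
    convert! hf2.add hg2 using 1
    ext z; simp [weighted, mul_add]
  smul_mem' := by
    rintro c f ⟨hf, hf2⟩
    refine ⟨hf.const_smul c, ?_⟩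
    rw [← memLp_weighted_iff hf.continuous] at hf2
    rw [← memLp_weighted_iff (hf.const_smul c).continuous]
    convert! hf2.const_smul c using 1
    ext z; simp [weighted, mul_left_comm]

/-- The Fock space of `ℂᵈ`. -/
def FockSpace (d : ℕ) : Type := fockSubmodule d

instance (d : ℕ) : AddCommGroup (FockSpace d) := inferInstanceAs (AddCommGroup (fockSubmodule d))

instance (d : ℕ) : Module ℂ (FockSpace d) := inferInstanceAs (Module ℂ (fockSubmodule d))

namespace FockSpace

variable {d : ℕ}

/-- An element of the Fock space as a function on `ℂᵈ`. -/
def toFun (f : FockSpace d) : (Fin d → ℂ) → ℂ := f.1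

instance : CoeFun (FockSpace d) (fun _ => (Fin d → ℂ) → ℂ) := ⟨toFun⟩

lemma mem (f : FockSpace d) : (f : (Fin d → ℂ) → ℂ) ∈ fockSubmodule d := f.2

lemma differentiable (f : FockSpace d) : Differentiable ℂ f := f.2.1

lemma ext {f g : FockSpace d} (h : ∀ z, f z = g z) : f = g := Subtype.ext (funext h)

@[simp] lemma add_apply (f g : FockSpace d) (z : Fin d → ℂ) : (f + g) z = f z + g z := rfl

@[simp] lemma sub_apply (f g : FockSpace d) (z : Fin d → ℂ) : (f - g) z = f z - g z := rfl

@[simp] lemma smul_apply (a : ℂ) (f : FockSpace d) (z : Fin d → ℂ) : (a • f) z = a * f z := rfl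

lemma memLp (f : FockSpace d) : MemLp (weighted f) 2 volume :=
  (memLp_weighted_iff f.differentiable.continuous).2 f.2.2

/-- The isometric embedding `f ↦ f √weight` into `L²` of Lebesgue measure. -/
def toL2 : FockSpace d →ₗ[ℂ] Lp ℂ 2 (volume : Measure (Fin d → ℂ)) where
  toFun f := f.memLp.toLp _
  map_add' f g := by
    rw [← MemLp.toLp_add]; congr 1; ext z; simp [weighted, mul_add]
  map_smul' c f := by
    rw [RingHom.id_apply, ← MemLp.toLp_const_smul]; congr 1; ext z
    simp [weighted, mul_left_comm]

/-- `∫ conj (f z) g(z) π⁻ᵈ exp (-|z|²) dV(z)`: Mathlib's inner products are conjugate linear in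
the first variable. -/
def innerFock (f g : FockSpace d) : ℂ := ∫ z, conj (f z) * g z * (weight z : ℂ)

lemma inner_toL2 (f g : FockSpace d) : inner ℂ (toL2 f) (toL2 g) = innerFock f g := by
  rw [L2.inner_def]
  refine integral_congr_ae ?_
  filter_upwards [f.memLp.coeFn_toLp, g.memLp.coeFn_toLp] with z hf hg
  change inner ℂ ((f.memLp.toLp _) z) ((g.memLp.toLp _) z) = _
  rw [hf, hg]
  have h : ((√(weight z) : ℝ) : ℂ) * (√(weight z) : ℝ) = (weight z : ℂ) := by
    rw [← Complex.ofReal_mul, Real.mul_self_sqrt (weight_pos z).le]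
  simp only [weighted, RCLike.inner_apply, map_mul, Complex.conj_ofReal]
  rw [← h]; ring

lemma toL2_injective : Function.Injective (toL2 (d := d)) := by
  intro f g h
  have h1 := (MemLp.toLp_eq_toLp_iff f.memLp g.memLp).1 h
  have h2 := (Continuous.ae_eq_iff_eq volume (continuous_weighted f.differentiable.continuous)
    (continuous_weighted g.differentiable.continuous)).1 h1
  refine ext fun z => ?_
  have h3 := congrFun h2 z
  have h4 : ((√(weight z) : ℝ) : ℂ) ≠ 0 := by
    exact_mod_cast (Real.sqrt_pos.2 (weight_pos z)).ne'
  exact mul_left_cancel₀ h4 h3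

/-- The inner product of the Fock space. -/
@[reducible] def core (d : ℕ) : InnerProductSpace.Core ℂ (FockSpace d) where
  inner := innerFock
  conj_inner_symm f g := by
    rw [← inner_toL2, ← inner_toL2, inner_conj_symm]
  re_inner_nonneg f := by
    rw [← inner_toL2]; exact inner_self_nonneg
  add_left f g h := by
    rw [← inner_toL2, ← inner_toL2, ← inner_toL2, map_add, inner_add_left]
  smul_left f g r := by
    rw [← inner_toL2, ← inner_toL2, map_smul, inner_smul_left]
  definite f h := by
    rw [← inner_toL2, inner_self_eq_zero] at h
    exact toL2_injective (by rw [h, map_zero])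

instance : NormedAddCommGroup (FockSpace d) :=
  @InnerProductSpace.Core.toNormedAddCommGroup ℂ _ _ _ _ (core d)

instance : InnerProductSpace ℂ (FockSpace d) := InnerProductSpace.ofCore (core d).toCore

lemma inner_def (f g : FockSpace d) :
    inner ℂ f g = ∫ z, conj (f z) * g z * (weight z : ℂ) := rfl

/-- The map `toL2` as a linear isometry. -/
def toL2Isometry : FockSpace d →ₗᵢ[ℂ] Lp ℂ 2 (volume : Measure (Fin d → ℂ)) :=
  toL2.isometryOfInner fun f g => inner_toL2 f g

/-! ### Completeness -/

/-- The mean value property over the unit polydisc. -/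
lemma mean_value_zero {g : (Fin d → ℂ) → ℂ} (hg : Differentiable ℂ g) :
    ∫ z in Metric.closedBall (0 : Fin d → ℂ) 1, g z =
      volume.real (Metric.closedBall (0 : Fin d → ℂ) 1) • g 0 := by
  set B := Metric.closedBall (0 : Fin d → ℂ) 1 with hB
  have hBc : IsCompact B := isCompact_closedBall _ _
  have hBm : MeasurableSet B := Metric.isClosed_closedBall.measurableSet
  have hinv : ∀ t : ℝ, ∫ z in B, g (fun i => circleMap 0 1 t * z i) = ∫ z in B, g z := by
    intro t
    have hne : circleMap 0 1 t ≠ 0 := circleMap_ne_center one_ne_zero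
    have hn : ‖circleMap 0 1 t‖ = 1 := by simp
    let u : Circle := ⟨circleMap 0 1 t, by simp [Submonoid.unitSphere]⟩
    have h1 : MeasurePreserving (fun z : Fin d → ℂ => fun i => circleMap 0 1 t * z i)
        volume volume := by
      refine volume_preserving_pi (f := fun _ w => circleMap 0 1 t * w) fun i => ?_
      exact (rotation u).measurePreserving
    let e : (Fin d → ℂ) ≃ₜ (Fin d → ℂ) :=
      Homeomorph.piCongrRight fun _ => Homeomorph.mulLeft₀ (circleMap 0 1 t) hne
    have h2 : MeasurableEmbedding (fun z : Fin d → ℂ => fun i => circleMap 0 1 t * z i) :=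
      e.measurableEmbedding
    have h3 := h1.setIntegral_preimage_emb h2 g B
    rw [← h3]
    congr 2
    ext z
    have : (fun i => circleMap 0 1 t * z i) = circleMap 0 1 t • z := rfl
    simp only [hB, Set.mem_preimage, Metric.mem_closedBall, dist_zero_right]
    rw [this, norm_smul, hn, one_mul]
  have hcirc : ∀ z : Fin d → ℂ,
      ∫ t in (0 : ℝ)..2 * Real.pi, g (fun i => circleMap 0 1 t * z i) =
        ((2 * Real.pi : ℝ) : ℂ) * g 0 := by
    intro z
    have h1 : Differentiable ℂ (fun w : ℂ => g (fun i => w * z i)) :=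
      hg.comp (by fun_prop)
    have h2 := (h1.diffContOnCl (s := Metric.ball 0 |1|)).circleAverage
    rw [Real.circleAverage_def] at h2
    have hpi : (2 * Real.pi : ℝ) ≠ 0 := by positivity
    have h3 : ∫ t in (0 : ℝ)..2 * Real.pi, g (fun i => circleMap 0 1 t * z i) =
        (2 * Real.pi : ℝ) • g (fun i => 0 * z i) := by
      rw [← h2, smul_smul, mul_inv_cancel₀ hpi, one_smul]
    rw [h3]
    simp only [zero_mul, Complex.real_smul]
    rfl
  have hswap : ∫ t in (0 : ℝ)..2 * Real.pi, ∫ z in B, g (fun i => circleMap 0 1 t * z i) =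
      ∫ z in B, ∫ t in (0 : ℝ)..2 * Real.pi, g (fun i => circleMap 0 1 t * z i) := by
    refine intervalIntegral_integral_swap ?_
    have hc : Continuous (Function.uncurry fun (t : ℝ) (z : Fin d → ℂ) =>
        g (fun i => circleMap 0 1 t * z i)) := by
      refine hg.continuous.comp (continuous_pi fun i => ?_)
      exact ((continuous_circleMap 0 1).comp continuous_fst).mul
        ((continuous_apply i).comp continuous_snd)
    rw [Measure.prod_restrict]
    refine IntegrableOn.mono_set ?_
      (Set.prod_mono Set.uIoc_subset_uIcc (le_refl B))
    exact hc.continuousOn.integrableOn_compact (isCompact_uIcc.prod hBc)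
  simp only [hinv, hcirc] at hswap
  simp only [intervalIntegral.integral_const, sub_zero, integral_const] at hswap
  rw [Complex.real_smul, measureReal_restrict_apply MeasurableSet.univ, Set.univ_inter] at hswap
  have hpi : ((2 * Real.pi : ℝ) : ℂ) ≠ 0 := by
    exact_mod_cast (by positivity : (2 * Real.pi : ℝ) ≠ 0)
  refine mul_left_cancel₀ hpi ?_
  rw [hswap, Complex.real_smul, Complex.real_smul]
  ring

lemma norm_eq_toL2 (f : FockSpace d) : ‖toL2 f‖ = ‖f‖ := toL2Isometry.norm_map f

lemma integral_norm_sq (f : FockSpace d) : ∫ z, ‖f z‖ ^ 2 * weight z = ‖f‖ ^ 2 := by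
  have h := inner_self_eq_norm_sq_to_K (𝕜 := ℂ) f
  rw [inner_def] at h
  have h2 : (∫ z, ((‖f z‖ ^ 2 * weight z : ℝ) : ℂ)) = ((‖f‖ ^ 2 : ℝ) : ℂ) := by
    push_cast
    rw [← Complex.coe_algebraMap] at h ⊢
    rw [← h]
    refine integral_congr_ae (Eventually.of_forall fun z => ?_)
    simp only [Complex.coe_algebraMap]
    rw [Complex.conj_mul']
  rw [integral_complex_ofReal] at h2
  exact_mod_cast h2

/-- Point evaluations are bounded, locally uniformly. -/
lemma exists_eval_bound (d : ℕ) (R : ℝ) :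
    ∃ C : ℝ, 0 ≤ C ∧ ∀ (f : FockSpace d) (a : Fin d → ℂ), ‖a‖ ≤ R → ‖f a‖ ≤ C * ‖f‖ := by
  set B := Metric.closedBall (0 : Fin d → ℂ) 1 with hB
  have hBc : IsCompact B := isCompact_closedBall _ _
  have hBm : MeasurableSet B := Metric.isClosed_closedBall.measurableSet
  have hv : 0 < volume.real B := by
    refine ENNReal.toReal_pos ?_ hBc.measure_lt_top.ne
    exact (Metric.measure_closedBall_pos volume 0 one_pos).ne'
  obtain ⟨m, hm, hmw⟩ : ∃ m : ℝ, 0 < m ∧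
      ∀ z ∈ Metric.closedBall (0 : Fin d → ℂ) (R + 1), m ≤ weight z := by
    rcases (Metric.closedBall (0 : Fin d → ℂ) (R + 1)).eq_empty_or_nonempty with he | hne
    · exact ⟨1, one_pos, by simp [he]⟩
    · obtain ⟨x, -, hx⟩ := (isCompact_closedBall (0 : Fin d → ℂ) (R + 1)).exists_isMinOn hne
        (continuous_weight d).continuousOn
      exact ⟨weight x, weight_pos x, fun z hz => hx hz⟩
  refine ⟨√((volume.real B * m)⁻¹), Real.sqrt_nonneg _, fun f a ha => ?_⟩
  have hf := f.differentiable
  have hsh : Differentiable ℂ fun z => f (a + z) := hf.comp (by fun_prop)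
  have h1 := mean_value_zero (hsh.mul hsh)
  have h2 : volume.real B * ‖f a‖ ^ 2 ≤ ∫ z in B, ‖f (a + z)‖ ^ 2 := by
    have h3 := norm_integral_le_integral_norm (μ := volume.restrict B)
      (fun z => f (a + z) * f (a + z))
    have h4 : ∫ z in B, f (a + z) * f (a + z) = volume.real B • (f a * f a) := by
      simpa using h1
    rw [h4, norm_smul, Real.norm_of_nonneg hv.le, norm_mul, ← sq] at h3
    refine h3.trans (le_of_eq ?_)
    simp only [norm_mul, pow_two]
  have hint : Integrable fun z => ‖f z‖ ^ 2 * weight z := f.2.2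
  have hint' := hint.comp_add_left a
  have h5 : ∫ z in B, m * ‖f (a + z)‖ ^ 2 ≤ ‖f‖ ^ 2 := by
    calc ∫ z in B, m * ‖f (a + z)‖ ^ 2
        ≤ ∫ z in B, ‖f (a + z)‖ ^ 2 * weight (a + z) := by
          refine setIntegral_mono_on ?_ hint'.integrableOn hBm fun z hz => ?_
          · have : Continuous fun z => m * ‖f (a + z)‖ ^ 2 := by
              have := hsh.continuous
              fun_prop
            exact this.continuousOn.integrableOn_compact hBc
          · rw [mul_comm]
            refine mul_le_mul_of_nonneg_left (hmw _ ?_) (by positivity)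
            rw [mem_closedBall_zero_iff] at hz ⊢
            exact (norm_add_le _ _).trans (add_le_add ha hz)
      _ ≤ ∫ z, ‖f (a + z)‖ ^ 2 * weight (a + z) :=
          setIntegral_le_integral hint' (Eventually.of_forall fun z =>
            mul_nonneg (by positivity) (weight_pos _).le)
      _ = ‖f‖ ^ 2 := by
          rw [integral_add_left_eq_self (fun z => ‖f z‖ ^ 2 * weight z) a, integral_norm_sq]
  rw [integral_const_mul] at h5
  have h6 : volume.real B * m * ‖f a‖ ^ 2 ≤ ‖f‖ ^ 2 := by
    nlinarith [mul_le_mul_of_nonneg_left h2 hm.le]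
  have h7 : ‖f a‖ ^ 2 ≤ (volume.real B * m)⁻¹ * ‖f‖ ^ 2 := by
    rw [inv_mul_eq_div, le_div_iff₀ (by positivity)]
    linarith
  calc ‖f a‖ = √(‖f a‖ ^ 2) := (Real.sqrt_sq (norm_nonneg _)).symm
    _ ≤ √((volume.real B * m)⁻¹ * ‖f‖ ^ 2) := Real.sqrt_le_sqrt h7
    _ = _ := by rw [Real.sqrt_mul (by positivity), Real.sqrt_sq (norm_nonneg _)]

/-- Derivatives at points are bounded, locally uniformly. -/
lemma exists_fderiv_bound (d : ℕ) (R : ℝ) :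
    ∃ C : ℝ, 0 ≤ C ∧
      ∀ (f : FockSpace d) (a : Fin d → ℂ), ‖a‖ ≤ R → ‖fderiv ℂ f a‖ ≤ C * ‖f‖ := by
  obtain ⟨C, hC, h⟩ := exists_eval_bound d (R + 1)
  refine ⟨2 * C, by positivity, fun f a ha => ?_⟩
  have := Complex.norm_fderiv_le_div_of_mapsTo_ball (f := f) (c := a) (R₁ := 1)
    (R₂ := 2 * C * ‖f‖) f.differentiable.differentiableOn ?_ one_pos
  · simpa using this
  · intro z hz
    have hz' : ‖z‖ ≤ R + 1 := by
      have h1 : ‖z - a‖ < 1 := by simpa [dist_eq_norm] using hz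
      have h2 : ‖z‖ ≤ ‖z - a‖ + ‖a‖ := by simpa using norm_add_le (z - a) a
      linarith
    have h1 := h f z hz'
    have h2 := h f a (by linarith)
    rw [Metric.mem_closedBall, dist_eq_norm]
    linarith [norm_sub_le (f z) (f a)]

instance : CompleteSpace (FockSpace d) := by
  refine Metric.complete_of_cauchySeq_tendsto fun u hu => ?_
  have hpt : ∀ z, ∃ l, Tendsto (fun n => u n z) atTop (𝓝 l) := fun z => by
    obtain ⟨C, hC, h⟩ := exists_eval_bound d ‖z‖
    refine cauchySeq_tendsto_of_complete ?_
    rw [Metric.cauchySeq_iff] at hu ⊢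
    intro ε hε
    obtain ⟨N, hN⟩ := hu (ε / (C + 1)) (by positivity)
    refine ⟨N, fun m hm n hn => ?_⟩
    have h1 := h (u m - u n) z le_rfl
    have h2 := hN m hm n hn
    rw [dist_eq_norm, lt_div_iff₀ (by positivity)] at h2
    rw [dist_eq_norm]
    rw [sub_apply] at h1
    nlinarith [norm_nonneg (u m - u n)]
  choose F hF using hpt
  have hder : ∀ R : ℝ, UniformCauchySeqOn (fun n => fderiv ℂ (u n)) atTop
      (Metric.ball (0 : Fin d → ℂ) R) := fun R => by
    obtain ⟨C, hC, h⟩ := exists_fderiv_bound d R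
    rw [Metric.uniformCauchySeqOn_iff]
    rw [Metric.cauchySeq_iff] at hu
    intro ε hε
    obtain ⟨N, hN⟩ := hu (ε / (C + 1)) (by positivity)
    refine ⟨N, fun m hm n hn z hz => ?_⟩
    have h1 := h (u m - u n) z (by simpa using (mem_ball_zero_iff.1 hz).le)
    have h2 := hN m hm n hn
    rw [dist_eq_norm, lt_div_iff₀ (by positivity)] at h2
    have h3 : fderiv ℂ (u m - u n : FockSpace d) z = fderiv ℂ (u m) z - fderiv ℂ (u n) z :=
      fderiv_sub ((u m).differentiable z) ((u n).differentiable z)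
    rw [dist_eq_norm, ← h3]
    nlinarith [norm_nonneg (u m - u n)]
  have hpt' : ∀ z, ∃ l, Tendsto (fun n => fderiv ℂ (u n) z) atTop (𝓝 l) := fun z =>
    cauchySeq_tendsto_of_complete
      ((hder (‖z‖ + 1)).cauchySeq (mem_ball_zero_iff.2 (lt_add_one _)))
  choose G hG using hpt'
  have hFd : Differentiable ℂ F := fun z => by
    refine (hasFDerivAt_of_tendstoUniformlyOn (g' := G) Metric.isOpen_ball
      ((hder (‖z‖ + 1)).tendstoUniformlyOn_of_tendsto fun w _ => hG w)
      (fun n w _ => ((u n).differentiable w).hasFDerivAt) (fun w _ => hF w)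
      (mem_ball_zero_iff.2 (lt_add_one _))).differentiableAt
  have hL : CauchySeq fun n => toL2 (u n) :=
    hu.map (toL2Isometry (d := d)).isometry.uniformContinuous
  obtain ⟨L, hL⟩ := cauchySeq_tendsto_of_complete hL
  have hm := tendstoInMeasure_of_tendsto_Lp hL
  obtain ⟨ns, hns, hae⟩ := hm.exists_seq_tendsto_ae
  have hFL : weighted F =ᵐ[volume] L := by
    have hall : ∀ᵐ z, ∀ n, toL2 (u n) z = weighted (u n) z :=
      ae_all_iff.2 fun n => (u n).memLp.coeFn_toLp
    filter_upwards [hae, hall] with z h1 h2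
    refine tendsto_nhds_unique ?_ h1
    simp only [h2, weighted]
    exact ((hF z).comp hns.tendsto_atTop).const_mul _
  have hFm : MemLp (weighted F) 2 volume := (memLp_congr_ae hFL).2 (Lp.memLp L)
  let f : FockSpace d := ⟨F, hFd, (memLp_weighted_iff hFd.continuous).1 hFm⟩
  have hfL : toL2 f = L := by
    refine Lp.ext ?_
    exact (f.memLp.coeFn_toLp).trans hFL
  refine ⟨f, ?_⟩
  rw [← hfL] at hL
  exact ((toL2Isometry (d := d)).isometry.isEmbedding.tendsto_nhds_iff).2 hL

end FockSpace

/-! ### Kernel functions -/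

lemma integrable_kernel {d : ℕ} (z : Fin d → ℂ) :
    Integrable (fun u => ‖Complex.exp (herm u z)‖ ^ 2 * weight u) := by
  have h1 : ∀ i, Integrable fun w : ℂ => Real.exp (2 * (w * conj (z i)).re - ‖w‖ ^ 2) := fun i => by
    have h := (GaussianFourier.integrable_cexp_neg_mul_sq_norm_add (V := ℂ) (b := 1)
      (by simp) 2 (z i)).norm
    refine h.congr (Eventually.of_forall fun w => ?_)
    simp only [Complex.norm_exp]
    congr 1
    rw [Complex.add_re]
    have h3 : (-1 * (‖w‖ : ℂ) ^ 2).re = -‖w‖ ^ 2 := by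
      rw [neg_one_mul, Complex.neg_re, ← Complex.ofReal_pow, Complex.ofReal_re]
    have h4 : (2 * ((inner ℝ (z i) w : ℝ) : ℂ)).re = 2 * (w * conj (z i)).re := by
      rw [Complex.inner]
      simp
    rw [h3, h4]; ring
  have h2 := (Integrable.fintype_prod h1).const_mul (1 / Real.pi ^ d)
  refine h2.congr (Eventually.of_forall fun u => ?_)
  simp only
  rw [← Real.exp_sum, Complex.norm_exp, ← Real.exp_nat_mul, weight, mul_left_comm,
    ← Real.exp_add, Finset.sum_sub_distrib, ← Finset.mul_sum]
  congr 2
  simp [herm, sqNorm, sub_eq_add_neg]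

/-- The kernel function `K_z(u) = exp ⟨u, z⟩`, an element of the Fock space. -/
def kernel {d : ℕ} (z : Fin d → ℂ) : FockSpace d :=
  ⟨fun u => Complex.exp (herm u z), by unfold herm; fun_prop, integrable_kernel z⟩

/-! ### Weighted composition operators -/

/-- The weighted composition expression `E_{ψ,φ} f = ψ · (f ∘ φ)`. -/
def weightedComp {d : ℕ} (ψ : (Fin d → ℂ) → ℂ) (φ : (Fin d → ℂ) → (Fin d → ℂ))
    (f : (Fin d → ℂ) → ℂ) : (Fin d → ℂ) → ℂ := fun z => ψ z * f (φ z)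

/-- The maximal weighted composition operator: it acts by `f ↦ ψ · (f ∘ φ)` on the domain of all
`f` in the Fock space for which `ψ · (f ∘ φ)` is in the Fock space. -/
def maxWCO {d : ℕ} (ψ : (Fin d → ℂ) → ℂ) (φ : (Fin d → ℂ) → (Fin d → ℂ)) :
    FockSpace d →ₗ.[ℂ] FockSpace d where
  domain :=
    { carrier := {f | weightedComp ψ φ f ∈ fockSubmodule d}
      zero_mem' := by
        have h : weightedComp ψ φ (0 : FockSpace d) = 0 := funext fun z => mul_zero _
        change weightedComp ψ φ (0 : FockSpace d) ∈ fockSubmodule d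
        rw [h]; exact Submodule.zero_mem _
      add_mem' := fun {f g} hf hg => by
        have h : weightedComp ψ φ (f + g : FockSpace d) =
            weightedComp ψ φ f + weightedComp ψ φ g := funext fun z => mul_add _ _ _
        change weightedComp ψ φ (f + g : FockSpace d) ∈ fockSubmodule d
        rw [h]; exact Submodule.add_mem _ hf hg
      smul_mem' := fun a f hf => by
        have h : weightedComp ψ φ (a • f : FockSpace d) = a • weightedComp ψ φ f :=
          funext fun z => mul_left_comm _ _ _
        change weightedComp ψ φ (a • f : FockSpace d) ∈ fockSubmodule d
        rw [h]; exact Submodule.smul_mem _ a hf }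
  toFun :=
    { toFun := fun f => (⟨weightedComp ψ φ f.1, f.2⟩ : fockSubmodule d)
      map_add' := fun _ _ => FockSpace.ext fun _ => mul_add _ _ _
      map_smul' := fun _ _ => FockSpace.ext fun _ => mul_left_comm _ _ _ }

/-! ### Complex symmetry -/

section Symmetry

variable {H : Type*} [NormedAddCommGroup H] [InnerProductSpace ℂ H]

/-- A conjugation: an antilinear isometric map that is involutive. -/
def IsConjugation (J : H →ₗᵢ⋆[ℂ] H) : Prop := ∀ f, J (J f) = f

/-- The operator `J S J`, with domain `{f | J f ∈ dom S}`. -/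
def conjOp (J : H →ₗᵢ⋆[ℂ] H) (S : H →ₗ.[ℂ] H) : H →ₗ.[ℂ] H where
  domain := S.domain.comap J.toLinearMap
  toFun :=
    { toFun := fun f => J (S ⟨J f, f.2⟩)
      map_add' := fun f g => by
        have h : (⟨J ((f + g : S.domain.comap J.toLinearMap) : H), (f + g).2⟩ : S.domain) =
            ⟨J f, f.2⟩ + ⟨J g, g.2⟩ := Subtype.ext (map_add J (f : H) g)
        rw [h, LinearPMap.map_add, map_add]
      map_smul' := fun a f => by
        have h : (⟨J ((a • f : S.domain.comap J.toLinearMap) : H), (a • f).2⟩ : S.domain) =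
            conj a • ⟨J f, f.2⟩ := Subtype.ext (J.map_smulₛₗ a (f : H))
        rw [h, LinearPMap.map_smul, LinearIsometry.map_smulₛₗ, RingHom.id_apply, Complex.conj_conj] }

variable [CompleteSpace H]

/-- A closed, densely defined operator `S` is `J`-symmetric if `S ≼ J S* J`. -/
def IsCSymmetric (J : H →ₗᵢ⋆[ℂ] H) (S : H →ₗ.[ℂ] H) : Prop :=
  S.IsClosed ∧ Dense (S.domain : Set H) ∧ S ≤ conjOp J S.adjoint

/-- A closed, densely defined operator `S` is `J`-selfadjoint if `S = J S* J`. -/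
def IsCSelfadjoint (J : H →ₗᵢ⋆[ℂ] H) (S : H →ₗ.[ℂ] H) : Prop :=
  S.IsClosed ∧ Dense (S.domain : Set H) ∧ S = conjOp J S.adjoint

end Symmetry

/-- `J` is the operator `J f (z) = c exp ⟨z, conj b⟩ conj (f (conj (A z + b)))`. -/
def IsWeightedConj {d : ℕ} (A : Matrix (Fin d) (Fin d) ℂ) (b : Fin d → ℂ) (c : ℂ)
    (J : FockSpace d → FockSpace d) : Prop :=
  ∀ (f : FockSpace d) (z : Fin d → ℂ),
    J f z = c * Complex.exp (herm z (star b)) * conj (f (star (A.mulVec z + b)))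

end Fock

end

noncomputable section

namespace Fock

variable {d : ℕ}

/-! ### The Gaussian measure and the reproducing property -/

/-! Write `S` for the maximal operator and `x·y` for the bilinear product; inner products are
conjugate linear in the first slot. Everything is tested on kernel functions: `⟨K_w, f⟩ = f(w)`
(`inner_kernel`), their span is dense (`dense_span_kernel`), and `J` maps each of them to a multiple
of another (`IsWeightedConj.map_kernel`), with `A` symmetric and injective.

Complex symmetry is symmetry of the bilinear form `⟨J g, S f⟩`. On the vectors `J K_z`, `J K_u` it
becomes an identity between exponentials (`IsCSymmetric.symbol_comm`), which makes `ψ` zero-free and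
`A(φ(z) - φ(0))·u` symmetric in `z` and `u`, hence linear in both. So `φ` is affine, and the
identity at `u = 0` then yields `ψ`.

Conversely, symbols of this form satisfy `S J K_z = ψ(z) J K_{φ(z)}`, and pairing with these vectors
gives `J S* J ≤ S` (`conjOp_adjoint_le`). The inclusion `S ≤ J S* J` is harder: it needs the
symmetry on all of `dom S`, while the kernel computation gives it only when one argument is a
kernel, and the kernels are not known to span a core. Dilations close the gap
(`inner_map_maxWCO_comm`). Put `D_r h(z) = e^{(1-r) z·conj ℓ} h(rz)` and `T_r f(z) = f(rz +
(1-r)q)`; then `D_r S f = S T_r f`. For small `|r|` the operator `S T_r` is bounded on the whole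
space, so `⟨J g, D_r S f⟩ = ⟨J S g, T_r f⟩` follows from the kernel case by density. Both sides are
holomorphic in `|r| < 1` and continuous on `[1/2, 1]`, so equality persists to `r = 1`, where it is
the required symmetry. -/

lemma exp_neg_mul_sqNorm (t : ℝ) (z : Fin d → ℂ) :
    Real.exp (-(t * sqNorm z)) = ∏ i, Real.exp (-t * ‖z i‖ ^ 2) := by
  rw [← Real.exp_sum, sqNorm, Finset.mul_sum, ← Finset.sum_neg_distrib]
  simp only [neg_mul]

lemma integrable_exp_neg_mul_sqNorm {t : ℝ} (ht : 0 < t) :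
    Integrable fun z : Fin d → ℂ => Real.exp (-(t * sqNorm z)) := by
  simp only [exp_neg_mul_sqNorm]
  refine Integrable.fintype_prod (f := fun (_ : Fin d) (w : ℂ) => Real.exp (-t * ‖w‖ ^ 2))
    fun _ => ?_
  have h := (GaussianFourier.integrable_cexp_neg_mul_sq_norm_add (V := ℂ) (b := t)
      (by simpa using ht) 0 0).norm
  refine h.congr (Eventually.of_forall fun w => ?_)
  simp only [Complex.norm_exp]
  congr 1
  simp [← Complex.ofReal_pow]

lemma integral_weight : ∫ z : Fin d → ℂ, weight z = 1 := by
  have h : ∀ z : Fin d → ℂ, weight z = (1 / Real.pi ^ d) * ∏ i, Real.exp (-1 * ‖z i‖ ^ 2) := by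
    intro z
    rw [weight, ← exp_neg_mul_sqNorm, one_mul]
  simp only [h]
  rw [integral_const_mul, integral_fintype_prod_volume_eq_pow (E := ℂ)
    (fun w : ℂ => Real.exp (-1 * ‖w‖ ^ 2)), GaussianFourier.integral_rexp_neg_mul_sq_norm one_pos]
  have : Real.pi ^ d ≠ 0 := by positivity
  simp [this]

lemma sqNorm_smul (r : ℂ) (z : Fin d → ℂ) : sqNorm (r • z) = ‖r‖ ^ 2 * sqNorm z := by
  simp [sqNorm, mul_pow, Finset.mul_sum]

lemma measurePreserving_circleMap_smul (t : ℝ) :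
    MeasurePreserving (fun z : Fin d → ℂ => circleMap 0 1 t • z) volume volume := by
  let u : Circle := ⟨circleMap 0 1 t, by simp [Submonoid.unitSphere]⟩
  refine volume_preserving_pi (f := fun _ w => circleMap 0 1 t * w) fun i => ?_
  exact (rotation u).measurePreserving

/-- The weight is invariant under `z ↦ e^{it} z`, so averaging over `t` leaves the integral
unchanged. By Fubini the average may be taken inside, where the one-variable mean value property on
each complex line replaces `g` by `g 0`; the total mass is one. -/
lemma integral_mul_weight_eq_apply_zero {g : (Fin d → ℂ) → ℂ} (hg : Differentiable ℂ g)
    (hi : Integrable fun z => g z * (weight z : ℂ)) :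
    ∫ z, g z * (weight z : ℂ) = g 0 := by
  set G : (Fin d → ℂ) → ℂ := fun z => g z * (weight z : ℂ) with hG
  have hGc : Continuous G := by
    have := continuous_weight d
    have := hg.continuous
    fun_prop
  have hwt : ∀ (t : ℝ) (z : Fin d → ℂ), weight (circleMap 0 1 t • z) = weight z := fun t z => by
    simp [weight, sqNorm_smul]
  have hemb : ∀ t : ℝ, MeasurableEmbedding (fun z : Fin d → ℂ => circleMap 0 1 t • z) := fun t =>
    (Homeomorph.smulOfNeZero (circleMap 0 1 t)
      (circleMap_ne_center one_ne_zero)).measurableEmbedding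
  have hinv : ∀ t : ℝ, ∫ z, G (circleMap 0 1 t • z) = ∫ z, G z := fun t =>
    (measurePreserving_circleMap_smul t).integral_comp (hemb t) G
  have hcirc : ∀ z, ∫ t in (0 : ℝ)..2 * Real.pi, G (circleMap 0 1 t • z) =
      ((2 * Real.pi : ℝ) : ℂ) * g 0 * (weight z : ℂ) := by
    intro z
    have h1 : Differentiable ℂ (fun w : ℂ => g (w • z)) := hg.comp (by fun_prop)
    have h2 := (h1.diffContOnCl (s := Metric.ball 0 |1|)).circleAverage
    rw [Real.circleAverage_def] at h2
    have hpi : (2 * Real.pi : ℝ) ≠ 0 := by positivity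
    have h3 : ∫ t in (0 : ℝ)..2 * Real.pi, g (circleMap 0 1 t • z) =
        (2 * Real.pi : ℝ) • g 0 := by
      rw [zero_smul] at h2
      rw [← h2, smul_smul, mul_inv_cancel₀ hpi, one_smul]
    simp only [hG, hwt]
    rw [intervalIntegral.integral_mul_const, h3, Complex.real_smul]
  have hswap : ∫ t in (0 : ℝ)..2 * Real.pi, ∫ z, G (circleMap 0 1 t • z) =
      ∫ z, ∫ t in (0 : ℝ)..2 * Real.pi, G (circleMap 0 1 t • z) := by
    refine intervalIntegral_integral_swap ?_
    have hc : Continuous (Function.uncurry fun (t : ℝ) (z : Fin d → ℂ) =>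
        G (circleMap 0 1 t • z)) := by
      refine hGc.comp ?_
      exact ((continuous_circleMap 0 1).comp continuous_fst).smul continuous_snd
    rw [integrable_prod_iff hc.aestronglyMeasurable]
    refine ⟨Eventually.of_forall fun t =>
      (measurePreserving_circleMap_smul t).integrable_comp_of_integrable hi, ?_⟩
    have : ∀ t : ℝ, ∫ z, ‖G (circleMap 0 1 t • z)‖ = ∫ z, ‖G z‖ := fun t =>
      (measurePreserving_circleMap_smul t).integral_comp (hemb t) fun z => ‖G z‖
    simp only [Function.uncurry_apply_pair, this]
    exact (intervalIntegrable_const (μ := volume) (a := 0) (b := 2 * Real.pi)).def'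
  simp only [hinv, hcirc] at hswap
  rw [intervalIntegral.integral_const, sub_zero, integral_const_mul, integral_complex_ofReal,
    integral_weight, Complex.real_smul, Complex.ofReal_one, mul_one] at hswap
  have hpi : ((2 * Real.pi : ℝ) : ℂ) ≠ 0 := by
    exact_mod_cast (by positivity : (2 * Real.pi : ℝ) ≠ 0)
  exact mul_left_cancel₀ hpi hswap

lemma herm_eq_dotProduct (z w : Fin d → ℂ) : herm z w = z ⬝ᵥ star w := rfl

lemma kernel_apply (w z : Fin d → ℂ) : kernel w z = Complex.exp (z ⬝ᵥ star w) := rfl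

lemma sqNorm_eq_dotProduct (z : Fin d → ℂ) : ((sqNorm z : ℝ) : ℂ) = z ⬝ᵥ star z := by
  simp [sqNorm, dotProduct, Complex.mul_conj']

lemma weight_eq_exp (z : Fin d → ℂ) :
    (weight z : ℂ) = (1 / Real.pi ^ d) * Complex.exp (-(z ⬝ᵥ star z)) := by
  rw [← sqNorm_eq_dotProduct]
  simp [weight]

lemma FockSpace.integrable_inner (f g : FockSpace d) :
    Integrable fun z => conj (f z) * g z * (weight z : ℂ) := by
  have h := L2.integrable_inner (𝕜 := ℂ) (toL2 f) (toL2 g)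
  refine h.congr ?_
  filter_upwards [f.memLp.coeFn_toLp, g.memLp.coeFn_toLp] with z hf hg
  change inner ℂ ((f.memLp.toLp _) z) ((g.memLp.toLp _) z) = _
  rw [hf, hg]
  have h : ((√(weight z) : ℝ) : ℂ) * (√(weight z) : ℝ) = (weight z : ℂ) := by
    rw [← Complex.ofReal_mul, Real.mul_self_sqrt (weight_pos z).le]
  simp only [weighted, RCLike.inner_apply, map_mul, Complex.conj_ofReal]
  rw [← h]; ring

/-- The reproducing property of the kernel functions. -/
lemma inner_kernel (w : Fin d → ℂ) (f : FockSpace d) : inner ℂ (kernel w) f = f w := by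
  -- Completing the square: after translation by `w`, the kernel and the shifted weight combine into
  -- the centred weight times an entire factor equal to `1` at the origin. The claim becomes the
  -- mean value property at `0`.
  have hshift : ∀ z, conj (kernel w (z + w)) * f (z + w) * (weight (z + w) : ℂ) =
      f (z + w) * Complex.exp (-(z ⬝ᵥ star w)) * (weight z : ℂ) := by
    intro z
    have hc : conj (kernel w (z + w)) = Complex.exp (star z ⬝ᵥ w + star w ⬝ᵥ w) := by
      rw [kernel_apply, ← Complex.exp_conj]
      congr 1
      change star _ = _
      rw [← Matrix.star_dotProduct_star, star_star, dotProduct_comm, star_add, add_dotProduct]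
    rw [hc, weight_eq_exp, weight_eq_exp]
    have : Complex.exp (star z ⬝ᵥ w + star w ⬝ᵥ w) * Complex.exp (-((z + w) ⬝ᵥ star (z + w))) =
        Complex.exp (-(z ⬝ᵥ star w)) * Complex.exp (-(z ⬝ᵥ star z)) := by
      rw [← Complex.exp_add, ← Complex.exp_add]
      congr 1
      simp only [star_add, add_dotProduct, dotProduct_add, dotProduct_comm (star z) w,
        dotProduct_comm (star w) w]
      ring
    linear_combination (f (z + w) * (1 / (Real.pi : ℂ) ^ d)) * this
  rw [FockSpace.inner_def, ← integral_add_right_eq_self _ w]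
  have hint := (FockSpace.integrable_inner (kernel w) f).comp_add_right w
  simp only [hshift] at hint ⊢
  rw [integral_mul_weight_eq_apply_zero (g := fun z => f (z + w) * Complex.exp (-(z ⬝ᵥ star w)))
    _ hint]
  · simp
  · have h1 : Differentiable ℂ fun z => f (z + w) := f.differentiable.comp (by fun_prop)
    have h2 : Differentiable ℂ fun z : Fin d → ℂ => Complex.exp (-(z ⬝ᵥ star w)) := by
      unfold dotProduct; fun_prop
    exact h1.mul h2

lemma inner_kernel_right (w : Fin d → ℂ) (f : FockSpace d) :
    inner ℂ f (kernel w) = conj (f w) := by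
  rw [← inner_conj_symm, inner_kernel]

lemma dense_span_kernel :
    Dense (Submodule.span ℂ (Set.range (kernel (d := d))) : Set (FockSpace d)) := by
  rw [Submodule.dense_iff_topologicalClosure_eq_top,
    Submodule.topologicalClosure_eq_top_iff, Submodule.eq_bot_iff]
  intro f hf
  refine FockSpace.ext fun z => ?_
  rw [← inner_kernel]
  exact hf _ (Submodule.subset_span ⟨z, rfl⟩)

lemma norm_kernel_sq (w : Fin d → ℂ) : ‖kernel w‖ ^ 2 = Real.exp (sqNorm w) := by
  have h := inner_self_eq_norm_sq_to_K (𝕜 := ℂ) (kernel w)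
  rw [inner_kernel, kernel_apply, ← sqNorm_eq_dotProduct, ← Complex.ofReal_exp] at h
  have h' : ((‖kernel w‖ ^ 2 : ℝ) : ℂ) = (Real.exp (sqNorm w) : ℝ) := by
    rw [Complex.ofReal_pow]; exact h.symm
  exact_mod_cast h'

lemma norm_apply_sq_le (f : FockSpace d) (z : Fin d → ℂ) :
    ‖f z‖ ^ 2 ≤ ‖f‖ ^ 2 * Real.exp (sqNorm z) := by
  rw [← norm_kernel_sq, ← inner_kernel, mul_comm, ← mul_pow]
  gcongr
  exact norm_inner_le_norm _ _

/-! ### Conjugations -/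

section Conjugation

variable {H : Type*} [NormedAddCommGroup H] [InnerProductSpace ℂ H] {J : H →ₗᵢ⋆[ℂ] H}

/-- Polarization: antilinearity exchanges the two terms carrying `Complex.I`, which conjugates the
inner product. -/
lemma inner_map_map_conj (J : H →ₗᵢ⋆[ℂ] H) (f g : H) : inner ℂ (J f) (J g) = inner ℂ g f := by
  have hI : J (Complex.I • g) = -(Complex.I • J g) := by
    rw [J.map_smulₛₗ]; simp
  have h1 : ‖J f + J g‖ = ‖f + g‖ := by rw [← map_add, J.norm_map]
  have h2 : ‖J f - J g‖ = ‖f - g‖ := by rw [← map_sub, J.norm_map]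
  have h3 : ‖J f - Complex.I • J g‖ = ‖f + Complex.I • g‖ := by
    rw [← J.norm_map (f + _), map_add, hI, sub_eq_add_neg]
  have h4 : ‖J f + Complex.I • J g‖ = ‖f - Complex.I • g‖ := by
    rw [← J.norm_map (f - _), map_sub, hI, sub_neg_eq_add]
  rw [← inner_conj_symm g f, inner_eq_sum_norm_sq_div_four, inner_eq_sum_norm_sq_div_four f g]
  simp only [RCLike.I_to_complex, h1, h2, h3, h4]
  simp only [map_div₀, map_add, map_sub, map_mul, map_pow, Complex.conj_I]
  simp only [Complex.coe_algebraMap, Complex.conj_ofReal, map_ofNat]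
  ring

lemma IsConjugation.inner_comm (hJ : IsConjugation J) (f g : H) :
    inner ℂ (J f) g = inner ℂ (J g) f := by
  conv_lhs => rw [← hJ g]
  rw [inner_map_map_conj]

end Conjugation

/-- Differentiating `exp ∘ F = 1` gives `F' = 0`, with no need to discuss branches of the logarithm.
-/
lemma exp_eq_one_const {E : Type*} [NormedAddCommGroup E] [NormedSpace ℂ E] {F : E → ℂ}
    (hF : Differentiable ℂ F) (h : ∀ z, Complex.exp (F z) = 1) (x y : E) : F x = F y := by
  refine is_const_of_fderiv_eq_zero hF (fun z => ?_) x y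
  have h1 := (hF z).hasFDerivAt.cexp
  have h2 : (fun z => Complex.exp (F z)) = fun _ => 1 := funext h
  rw [h2, h z, one_smul] at h1
  exact h1.unique (hasFDerivAt_const _ _)

/-- A single exponential determines its exponent only modulo `2πi`; the free scale `t` removes the
ambiguity. -/
lemma eq_of_forall_exp_mul_eq {α β : ℂ} (h : ∀ t : ℂ, Complex.exp (t * α) = Complex.exp (t * β)) :
    α = β := by
  have := exp_eq_one_const (F := fun t : ℂ => t * α - t * β) (by fun_prop)
    (fun t => by rw [Complex.exp_sub, h, div_self (Complex.exp_ne_zero _)]) 1 0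
  simpa [sub_eq_zero] using this

/-! ### The weighted conjugation on kernel functions -/

section WeightedConj

variable {A : Matrix (Fin d) (Fin d) ℂ} {b : Fin d → ℂ} {c : ℂ}
    {J : FockSpace d →ₗᵢ⋆[ℂ] FockSpace d}

open Matrix

lemma star_star_dotProduct (x y : Fin d → ℂ) : conj (star x ⬝ᵥ star y) = x ⬝ᵥ y := by
  rw [Matrix.star_dotProduct_star, starRingEnd_apply, star_star, dotProduct_comm]

lemma IsWeightedConj.kernel_apply (h : IsWeightedConj A b c J) (u x : Fin d → ℂ) :
    J (kernel u) x = c * Complex.exp (x ⬝ᵥ b + (A *ᵥ x + b) ⬝ᵥ u) := by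
  rw [h, Fock.kernel_apply, ← Complex.exp_conj, star_star_dotProduct, herm_eq_dotProduct,
    star_star, mul_assoc, ← Complex.exp_add]

lemma IsWeightedConj.ne_zero (h : IsWeightedConj A b c J) : c ≠ 0 := by
  rintro rfl
  have h1 : J (kernel 0) = J 0 := by
    rw [map_zero]
    exact FockSpace.ext fun z => by rw [h.kernel_apply, zero_mul]; rfl
  have h2 : kernel (0 : Fin d → ℂ) 0 = (0 : FockSpace d) 0 := by rw [J.injective h1]
  rw [Fock.kernel_apply] at h2
  simp at h2
  exact one_ne_zero h2

/-- For a conjugation `⟨J f, g⟩` is symmetric in `f` and `g`, so `J K_u(x) = J K_x(u)`. The factors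
involving `b` cancel, and scaling `u` allows the exponents themselves to be compared. -/
lemma IsWeightedConj.transpose_eq (h : IsWeightedConj A b c J) (hJ : IsConjugation J) :
    Aᵀ = A := by
  have key : ∀ u x : Fin d → ℂ, A *ᵥ x ⬝ᵥ u = A *ᵥ u ⬝ᵥ x := by
    intro u x
    refine eq_of_forall_exp_mul_eq fun t => ?_
    have h1 := hJ.inner_comm (kernel (t • u)) (kernel x)
    rw [inner_kernel_right, inner_kernel_right] at h1
    have h2 := (starRingEnd ℂ).injective h1
    rw [h.kernel_apply, h.kernel_apply] at h2
    have h3 := mul_left_cancel₀ h.ne_zero h2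
    simp only [add_dotProduct, Complex.exp_add, dotProduct_comm (t • u) b, dotProduct_comm x b,
      mulVec_smul, dotProduct_smul, smul_dotProduct, smul_eq_mul, mul_add, Complex.exp_add] at h3 ⊢
    have e1 := Complex.exp_ne_zero (b ⬝ᵥ x)
    have e2 := Complex.exp_ne_zero (t * (b ⬝ᵥ u))
    refine mul_left_cancel₀ (mul_ne_zero e1 e2) ?_
    linear_combination h3
  ext i j
  have := key (Pi.single i 1) (Pi.single j 1)
  simpa using this.symm

lemma mulVec_dotProduct_comm (hA : Aᵀ = A) (x y : Fin d → ℂ) :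
    A *ᵥ x ⬝ᵥ y = A *ᵥ y ⬝ᵥ x := by
  rw [dotProduct_comm, dotProduct_mulVec, ← mulVec_transpose, hA]

lemma IsWeightedConj.map_kernel (h : IsWeightedConj A b c J) (hJ : IsConjugation J)
    (u : Fin d → ℂ) :
    J (kernel u) = (c * Complex.exp (b ⬝ᵥ u)) • kernel (star (A *ᵥ u + b)) := by
  refine FockSpace.ext fun x => ?_
  rw [h.kernel_apply, FockSpace.smul_apply, Fock.kernel_apply, star_star, mul_assoc,
    ← Complex.exp_add]
  congr 2
  rw [add_dotProduct, mulVec_dotProduct_comm (h.transpose_eq hJ), dotProduct_add,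
    dotProduct_comm _ x]
  ring

/-- If `A v = 0`, then `J K_v` is a multiple of `J K_0`, so `K_v` is constant. Its values at `0` and
`v` are `1` and `exp |v|²`, whence `v = 0`. -/
lemma IsWeightedConj.mulVec_injective (h : IsWeightedConj A b c J) (hJ : IsConjugation J) :
    Function.Injective A.mulVec := by
  refine (injective_iff_map_eq_zero A.mulVecLin).2 fun v hv => ?_
  replace hv : A *ᵥ v = 0 := hv
  have h1 : J (kernel v) = J (conj (Complex.exp (b ⬝ᵥ v)) • kernel 0) := by
    rw [J.map_smulₛₗ, Complex.conj_conj, h.map_kernel hJ, h.map_kernel hJ, hv]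
    simp [smul_smul, mul_comm]
  have h2 : ∀ z, kernel v z = conj (Complex.exp (b ⬝ᵥ v)) * kernel 0 z := fun z => by
    rw [J.injective h1]; rfl
  have h3 := h2 0
  have h4 := h2 v
  simp only [Fock.kernel_apply, zero_dotProduct, star_zero, dotProduct_zero, Complex.exp_zero,
    mul_one] at h3 h4
  rw [← h3, ← sqNorm_eq_dotProduct, ← Complex.ofReal_exp] at h4
  have h5 : Real.exp (sqNorm v) = 1 := by exact_mod_cast h4
  rw [Real.exp_eq_one_iff, sqNorm, Finset.sum_eq_zero_iff_of_nonneg fun i _ => by positivity] at h5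
  ext i
  simpa using h5 i (Finset.mem_univ i)

end WeightedConj

/-! ### The form of the symbols of a complex symmetric operator -/

lemma maxWCO_apply {ψ : (Fin d → ℂ) → ℂ} {φ : (Fin d → ℂ) → (Fin d → ℂ)}
    (f : (maxWCO ψ φ).domain) (z : Fin d → ℂ) :
    maxWCO ψ φ f z = ψ z * (f : FockSpace d) (φ z) := rfl

section Symbols

variable {A : Matrix (Fin d) (Fin d) ℂ} {b : Fin d → ℂ} {c : ℂ}
    {J : FockSpace d →ₗᵢ⋆[ℂ] FockSpace d} {ψ : (Fin d → ℂ) → ℂ} {φ : (Fin d → ℂ) → (Fin d → ℂ)}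

open Matrix

/-- This trades the adjoint, whose domain is not explicit, for a symmetric bilinear form on `dom S`;
`le_conjOp_adjoint` is the converse. -/
lemma IsCSymmetric.inner_comm {H : Type*} [NormedAddCommGroup H] [InnerProductSpace ℂ H]
    [CompleteSpace H] {J : H →ₗᵢ⋆[ℂ] H} {S : H →ₗ.[ℂ] H}
    (hS : IsCSymmetric J S) (f g : S.domain) :
    inner ℂ (J g) (S f) = inner ℂ (J f) (S g) := by
  obtain ⟨-, hd, hle⟩ := hS
  have hf : J f ∈ S.adjoint.domain := hle.1 f.2
  have h1 : S f = J (S.adjoint ⟨J f, hf⟩) := hle.2 (x := f) (y := ⟨f, hf⟩) rfl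
  rw [h1, inner_map_map_conj]
  exact LinearPMap.adjoint_isFormalAdjoint hd ⟨J f, hf⟩ g

lemma map_kernel_mem_domain (hJ : IsConjugation J) (hJform : IsWeightedConj A b c J)
    (hker : ∀ w, kernel w ∈ (maxWCO ψ φ).domain) (w : Fin d → ℂ) :
    J (kernel w) ∈ (maxWCO ψ φ).domain := by
  rw [hJform.map_kernel hJ]
  exact Submodule.smul_mem _ _ (hker _)

lemma IsCSymmetric.symbol_comm (hJ : IsConjugation J) (hJform : IsWeightedConj A b c J)
    (hker : ∀ w, kernel w ∈ (maxWCO ψ φ).domain) (hS : IsCSymmetric J (maxWCO ψ φ))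
    (z u : Fin d → ℂ) :
    ψ z * Complex.exp (φ z ⬝ᵥ b + (A *ᵥ φ z + b) ⬝ᵥ u) =
      ψ u * Complex.exp (φ u ⬝ᵥ b + (A *ᵥ φ u + b) ⬝ᵥ z) := by
  have h := hS.inner_comm ⟨_, map_kernel_mem_domain hJ hJform hker u⟩
    ⟨_, map_kernel_mem_domain hJ hJform hker z⟩
  simp only [hJ (kernel _), inner_kernel, maxWCO_apply, hJform.kernel_apply] at h
  refine mul_left_cancel₀ hJform.ne_zero ?_
  linear_combination h

lemma IsCSymmetric.exists_symbols (hJ : IsConjugation J) (hJform : IsWeightedConj A b c J)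
    (hψ0 : ψ ≠ 0) (hφ : Differentiable ℂ φ)
    (hker : ∀ w, kernel w ∈ (maxWCO ψ φ).domain) (hS : IsCSymmetric J (maxWCO ψ φ)) :
    ∃ (θ : ℂ) (l q : Fin d → ℂ) (Q : Matrix (Fin d) (Fin d) ℂ),
      ψ = (fun z => θ * Complex.exp (herm z l)) ∧ φ = (fun z => Q *ᵥ z + q) ∧
      (A * Q)ᵀ = A * Q ∧ l = star (A *ᵥ q) + star b - Qᴴ *ᵥ star b := by
  have hA := hJform.transpose_eq hJ
  have key := hS.symbol_comm hJ hJform hker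
  -- One zero of `ψ` would spread to every point through `key`, since exponentials do not vanish.
  have hne : ∀ z, ψ z ≠ 0 := by
    intro u hu
    refine hψ0 (funext fun z => ?_)
    have h := key z u
    rw [hu, zero_mul] at h
    exact (mul_eq_zero.1 h).resolve_right (Complex.exp_ne_zero _)
  set q := φ 0 with hq
  have h0 : ∀ z, ψ z * Complex.exp (φ z ⬝ᵥ b) =
      ψ 0 * Complex.exp (q ⬝ᵥ b + (A *ᵥ q + b) ⬝ᵥ z) := fun z => by
    simpa using key z 0
  -- Dividing `key` by its two instances with one argument `0` leaves `exp (F z) = 1`. So `F` is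
  -- constant, and `F 0 = 0` because `q = φ 0`.
  have h1 : ∀ z u, A *ᵥ (φ z - q) ⬝ᵥ u = A *ᵥ (φ u - q) ⬝ᵥ z := by
    intro z u
    set F : (Fin d → ℂ) → ℂ := fun z => A *ᵥ (φ z - q) ⬝ᵥ u - A *ᵥ (φ u - q) ⬝ᵥ z with hF
    have hFd : Differentiable ℂ F := by
      have : Differentiable ℂ fun z => φ z - q := hφ.sub_const q
      have hm : Differentiable ℂ fun z => A.mulVec z := A.mulVecLin.toContinuousLinearMap.differentiable
      have h2 : Differentiable ℂ fun z => A *ᵥ (φ z - q) := hm.comp this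
      have h3 := differentiable_pi.1 h2
      simp only [hF, dotProduct]
      fun_prop
    have hF1 : ∀ z, Complex.exp (F z) = 1 := by
      intro z
      have hzu := key z u
      have hz := h0 z
      have hu := h0 u
      have hz0 : ψ 0 * Complex.exp (q ⬝ᵥ b) ≠ 0 := mul_ne_zero (hne 0) (Complex.exp_ne_zero _)
      simp only [add_dotProduct, Complex.exp_add, hF, mulVec_sub, sub_dotProduct,
        Complex.exp_sub] at hzu hz hu ⊢
      have e1 := Complex.exp_ne_zero (A *ᵥ q ⬝ᵥ u)
      have e2 := Complex.exp_ne_zero (A *ᵥ q ⬝ᵥ z)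
      have e3 := Complex.exp_ne_zero (A *ᵥ φ u ⬝ᵥ z)
      have e4 := Complex.exp_ne_zero (b ⬝ᵥ u)
      have e5 := Complex.exp_ne_zero (b ⬝ᵥ z)
      have h2 : Complex.exp (A *ᵥ q ⬝ᵥ z) * Complex.exp (A *ᵥ φ z ⬝ᵥ u) =
          Complex.exp (A *ᵥ q ⬝ᵥ u) * Complex.exp (A *ᵥ φ u ⬝ᵥ z) := by
        refine mul_left_cancel₀ (mul_ne_zero hz0 (mul_ne_zero e4 e5)) ?_
        linear_combination hzu - Complex.exp (A *ᵥ φ z ⬝ᵥ u) * Complex.exp (b ⬝ᵥ u) * hz +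
          Complex.exp (A *ᵥ φ u ⬝ᵥ z) * Complex.exp (b ⬝ᵥ z) * hu
      field_simp
      linear_combination h2
    have h2 := exp_eq_one_const hFd hF1 z 0
    simpa [hF, ← hq, sub_eq_zero] using h2
  have hinj := hJform.mulVec_injective hJ
  -- The right side of `h1` is linear in `z`, hence so is `A (φ z - q)`, and injectivity of `A`
  -- passes this to `φ z - q`.
  have hlin : ∃ L : (Fin d → ℂ) →ₗ[ℂ] (Fin d → ℂ), ∀ z, L z = φ z - q := by
    refine ⟨{ toFun := fun z => φ z - q, map_add' := fun x y => ?_, map_smul' := fun a x => ?_ },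
      fun z => rfl⟩
    · refine hinj (dotProduct_eq _ _ fun u => ?_)
      rw [h1, mulVec_add, add_dotProduct, h1 x, h1 y, dotProduct_add]
    · refine hinj (dotProduct_eq _ _ fun u => ?_)
      rw [h1, mulVec_smul, smul_dotProduct, h1 x, dotProduct_smul, RingHom.id_apply]
  obtain ⟨L, hL⟩ := hlin
  have hLQ : ∀ z, (LinearMap.toMatrix' L) *ᵥ z = φ z - q := fun z => by
    rw [LinearMap.toMatrix'_mulVec, hL]
  set Q := LinearMap.toMatrix' L
  refine ⟨ψ 0, _, q, Q, funext fun z => ?_, funext fun z => by rw [hLQ]; simp, ?_, rfl⟩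
  · have h2 := h0 z
    have h3 : φ z = Q *ᵥ z + q := by rw [hLQ]; simp
    -- The term `Qᴴ *ᵥ star b` of `ℓ` is there to cancel the linear part of `φ z ⬝ᵥ b`.
    have e : herm z (star (A *ᵥ q) + star b - Qᴴ *ᵥ star b) + φ z ⬝ᵥ b =
        q ⬝ᵥ b + (A *ᵥ q + b) ⬝ᵥ z := by
      rw [herm_eq_dotProduct, h3, star_sub, star_add, star_star, star_star, star_mulVec, star_star,
        conjTranspose_conjTranspose, dotProduct_sub, ← dotProduct_comm z, add_dotProduct,
        dotProduct_comm z (b ᵥ* Q), ← dotProduct_mulVec, dotProduct_comm b (Q *ᵥ z)]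
      ring
    rw [← e, Complex.exp_add] at h2
    refine mul_right_cancel₀ (Complex.exp_ne_zero (φ z ⬝ᵥ b)) ?_
    linear_combination h2
  · ext i j
    have h2 := h1 (Pi.single i 1) (Pi.single j 1)
    rw [← hLQ, ← hLQ, mulVec_mulVec, mulVec_mulVec] at h2
    simpa using h2

end Symbols

/-! ### Estimates for Gaussian exponents -/

/-- Young's inequality `2xy ≤ εx² + ε⁻¹y²` in each coordinate: a linear exponent costs an
arbitrarily small part of the Gaussian. -/
lemma norm_exp_dotProduct_sq_le {ε : ℝ} (hε : 0 < ε) (z a : Fin d → ℂ) :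
    ‖Complex.exp (z ⬝ᵥ a)‖ ^ 2 ≤ Real.exp (ε * sqNorm z + ε⁻¹ * sqNorm a) := by
  rw [Complex.norm_exp, ← Real.exp_nat_mul, Real.exp_le_exp]
  simp only [dotProduct, Complex.re_sum, sqNorm, Finset.mul_sum, ← Finset.sum_add_distrib]
  refine Finset.sum_le_sum fun i _ => ?_
  have h1 : (z i * a i).re ≤ ‖z i‖ * ‖a i‖ := (Complex.re_le_norm _).trans (norm_mul _ _).le
  have h2 : 0 ≤ ε⁻¹ * (ε * ‖z i‖ - ‖a i‖) ^ 2 := by positivity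
  have h3 : ε⁻¹ * (ε * ‖z i‖ - ‖a i‖) ^ 2 =
      ε * ‖z i‖ ^ 2 - 2 * (‖z i‖ * ‖a i‖) + ε⁻¹ * ‖a i‖ ^ 2 := by
    field_simp
    ring
  push_cast
  linarith

lemma sqNorm_add_le {ε : ℝ} (hε : 0 < ε) (x y : Fin d → ℂ) :
    sqNorm (x + y) ≤ (1 + ε) * sqNorm x + (1 + ε⁻¹) * sqNorm y := by
  simp only [sqNorm, Finset.mul_sum, ← Finset.sum_add_distrib]
  refine Finset.sum_le_sum fun i _ => ?_
  have h1 : ‖(x + y) i‖ ^ 2 ≤ (‖x i‖ + ‖y i‖) ^ 2 := by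
    gcongr
    exact norm_add_le _ _
  have h2 : 0 ≤ ε⁻¹ * (ε * ‖x i‖ - ‖y i‖) ^ 2 := by positivity
  have h3 : ε⁻¹ * (ε * ‖x i‖ - ‖y i‖) ^ 2 =
      ε * ‖x i‖ ^ 2 - 2 * (‖x i‖ * ‖y i‖) + ε⁻¹ * ‖y i‖ ^ 2 := by
    field_simp
    ring
  nlinarith

lemma sqNorm_convex_comb_le {r : ℝ} (h0 : 0 ≤ r) (h1 : r ≤ 1) (x y : Fin d → ℂ) :
    sqNorm ((r : ℂ) • x + (1 - r : ℂ) • y) ≤ r * sqNorm x + (1 - r) * sqNorm y := by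
  simp only [sqNorm, Finset.mul_sum, ← Finset.sum_add_distrib]
  refine Finset.sum_le_sum fun i _ => ?_
  have h2 : ‖((r : ℂ) • x + (1 - r : ℂ) • y) i‖ ≤ r * ‖x i‖ + (1 - r) * ‖y i‖ := by
    refine (norm_add_le _ _).trans (le_of_eq ?_)
    have h3 : (1 - r : ℂ) = ((1 - r : ℝ) : ℂ) := by push_cast; rfl
    rw [h3]
    simp only [Pi.smul_apply, norm_smul, Complex.norm_real, Real.norm_eq_abs, abs_of_nonneg h0,
      abs_of_nonneg (sub_nonneg.2 h1)]
  have h4 : ‖((r : ℂ) • x + (1 - r : ℂ) • y) i‖ ^ 2 ≤ (r * ‖x i‖ + (1 - r) * ‖y i‖) ^ 2 := by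
    gcongr
  nlinarith [mul_nonneg (mul_nonneg h0 (sub_nonneg.2 h1)) (sq_nonneg (‖x i‖ - ‖y i‖))]

lemma exists_sqNorm_mulVec_le (Q : Matrix (Fin d) (Fin d) ℂ) :
    ∃ K : ℝ, 0 ≤ K ∧ ∀ z, sqNorm (Q.mulVec z) ≤ K * sqNorm z := by
  refine ⟨∑ i, ∑ j, ‖Q i j‖ ^ 2, by positivity, fun z => ?_⟩
  rw [sqNorm, Finset.sum_mul]
  refine Finset.sum_le_sum fun i _ => ?_
  refine le_trans ?_ (Finset.sum_mul_sq_le_sq_mul_sq Finset.univ (fun j => ‖Q i j‖) fun j => ‖z j‖)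
  gcongr
  refine (norm_sum_le Finset.univ fun j => Q i j * z j).trans (le_of_eq ?_)
  simp only [norm_mul]

/-! ### Bounded weighted composition operators -/

/-- Weighted composition operators whose symbols have a Gaussian gain are bounded. -/
lemma exists_bounded_weightedComp (d : ℕ) {ρ : ℝ} (hρ : ρ < 1) (R : ℝ) :
    ∃ C : ℝ, ∀ (m : (Fin d → ℂ) → ℂ) (φ : (Fin d → ℂ) → (Fin d → ℂ)),
      Differentiable ℂ m → Differentiable ℂ φ →
      (∀ z, ‖m z‖ ^ 2 * Real.exp (sqNorm (φ z)) ≤ Real.exp (R + ρ * sqNorm z)) →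
      ∃ Y : FockSpace d →L[ℂ] FockSpace d, (∀ f, ‖Y f‖ ≤ C * ‖f‖) ∧
        ∀ f z, Y f z = m z * f (φ z) := by
  -- The bound `‖f (φ z)‖² ≤ ‖f‖² exp |φ z|²` and the hypothesis on the symbols leave this Gaussian
  -- as majorant. The constant depends only on `d`, `ρ` and `R`, so it is uniform over the symbols.
  set I : ℝ := Real.exp R * (1 / Real.pi ^ d) *
    ∫ z : Fin d → ℂ, Real.exp (-((1 - ρ) * sqNorm z)) with hI
  have hI0 : 0 ≤ I := by
    have : 0 ≤ ∫ z : Fin d → ℂ, Real.exp (-((1 - ρ) * sqNorm z)) :=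
      integral_nonneg fun z => (Real.exp_pos _).le
    positivity
  refine ⟨√I, fun m φ hm hφ hb => ?_⟩
  have hgauss := integrable_exp_neg_mul_sqNorm (d := d) (sub_pos.2 hρ)
  have hpt : ∀ (f : FockSpace d) z, ‖weightedComp m φ f z‖ ^ 2 * weight z ≤
      ‖f‖ ^ 2 * (Real.exp R * (1 / Real.pi ^ d)) * Real.exp (-((1 - ρ) * sqNorm z)) := by
    intro f z
    calc ‖weightedComp m φ f z‖ ^ 2 * weight z
        = ‖m z‖ ^ 2 * ‖f (φ z)‖ ^ 2 * weight z := by rw [weightedComp, norm_mul, mul_pow]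
      _ ≤ ‖m z‖ ^ 2 * (‖f‖ ^ 2 * Real.exp (sqNorm (φ z))) * weight z := by
        have := (weight_pos z).le
        gcongr
        exact norm_apply_sq_le f _
      _ = (‖m z‖ ^ 2 * Real.exp (sqNorm (φ z))) * (‖f‖ ^ 2 * weight z) := by ring
      _ ≤ Real.exp (R + ρ * sqNorm z) * (‖f‖ ^ 2 * weight z) := by
        have := (weight_pos z).le
        gcongr
        exact hb z
      _ = _ := by
        have : -((1 - ρ) * sqNorm z) = ρ * sqNorm z + -sqNorm z := by ring
        rw [weight, this, Real.exp_add, Real.exp_add]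
        ring
  have hdiff : ∀ f : FockSpace d, Differentiable ℂ (weightedComp m φ f) := fun f =>
    hm.mul (f.differentiable.comp hφ)
  have hmem : ∀ f : FockSpace d, weightedComp m φ f ∈ fockSubmodule d := by
    intro f
    refine ⟨hdiff f, (hgauss.const_mul (‖f‖ ^ 2 * (Real.exp R * (1 / Real.pi ^ d)))).mono' ?_
      (Eventually.of_forall fun z => ?_)⟩
    · have := (hdiff f).continuous
      have := continuous_weight d
      exact Continuous.aestronglyMeasurable (by fun_prop)
    · rw [Real.norm_of_nonneg (mul_nonneg (by positivity) (weight_pos z).le)]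
      exact hpt f z
  let Y₀ : FockSpace d →ₗ[ℂ] FockSpace d :=
    { toFun := fun f => (⟨weightedComp m φ f, hmem f⟩ : fockSubmodule d)
      map_add' := fun _ _ => FockSpace.ext fun _ => mul_add _ _ _
      map_smul' := fun _ _ => FockSpace.ext fun _ => mul_left_comm _ _ _ }
  have hbound : ∀ f, ‖Y₀ f‖ ≤ √I * ‖f‖ := by
    intro f
    refine le_of_sq_le_sq ?_ (by positivity)
    rw [mul_pow, Real.sq_sqrt hI0, ← FockSpace.integral_norm_sq]
    calc ∫ z, ‖Y₀ f z‖ ^ 2 * weight z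
        ≤ ∫ z, ‖f‖ ^ 2 * (Real.exp R * (1 / Real.pi ^ d)) *
            Real.exp (-((1 - ρ) * sqNorm z)) :=
          integral_mono (Y₀ f).mem.2 (hgauss.const_mul _) (hpt f)
      _ = I * ‖f‖ ^ 2 := by rw [integral_const_mul, hI]; ring
  exact ⟨Y₀.mkContinuous _ hbound, hbound, fun f z => rfl⟩

/-! ### Weak limits -/

/-- On a bounded family, approximating `G` by combinations of kernels is uniform in the parameter.
Pairing with such a combination involves only finitely many point values, so regularity of point
values passes to all inner products in the two lemmas that follow. -/
lemma exists_tendstoUniformlyOn_inner {X : Type*} (u : X → FockSpace d) {s : Set X} {C : ℝ}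
    (hC : ∀ x ∈ s, ‖u x‖ ≤ C) (G : FockSpace d) :
    ∃ g : ℕ → FockSpace d, (∀ n, g n ∈ Submodule.span ℂ (Set.range (kernel (d := d)))) ∧
      TendstoUniformlyOn (fun n x => inner ℂ (g n) (u x)) (fun x => inner ℂ G (u x)) atTop s := by
  obtain ⟨g, hg, hlim⟩ := mem_closure_iff_seq_limit.1 (dense_span_kernel G)
  refine ⟨g, hg, ?_⟩
  rw [Metric.tendstoUniformlyOn_iff]
  intro ε hε
  have h1 : ∀ᶠ n in atTop, ‖G - g n‖ * (|C| + 1) < ε := by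
    have h2 : Tendsto (fun n => ‖G - g n‖ * (|C| + 1)) atTop (𝓝 (‖G - G‖ * (|C| + 1))) :=
      ((tendsto_const_nhds.sub hlim).norm).mul_const _
    rw [sub_self, norm_zero, zero_mul] at h2
    exact h2.eventually_lt_const hε
  filter_upwards [h1] with n hn x hx
  rw [dist_eq_norm, ← inner_sub_left]
  refine (norm_inner_le_norm _ _).trans_lt (lt_of_le_of_lt ?_ hn)
  gcongr
  linarith [hC x hx, le_abs_self C]

lemma continuousOn_inner_of_bounded {X : Type*} [TopologicalSpace X] (u : X → FockSpace d)
    {s : Set X} {C : ℝ} (hC : ∀ x ∈ s, ‖u x‖ ≤ C) (hu : ∀ z, ContinuousOn (fun x => u x z) s)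
    (G : FockSpace d) : ContinuousOn (fun x => (inner ℂ G (u x) : ℂ)) s := by
  obtain ⟨g, hg, hlim⟩ := exists_tendstoUniformlyOn_inner u hC G
  refine hlim.continuousOn (Frequently.of_forall fun n => ?_)
  have hn := hg n
  generalize g n = y at hn
  induction hn using Submodule.span_induction with
  | mem x hx => obtain ⟨w, rfl⟩ := hx; simpa only [inner_kernel] using hu w
  | zero => simpa only [inner_zero_left] using continuousOn_const
  | add x y _ _ hx hy => simp only [inner_add_left]; exact hx.add hy
  | smul a x _ hx => simpa only [inner_smul_left] using hx.const_mul (conj a)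

lemma differentiableOn_inner_of_bounded (u : ℂ → FockSpace d) {s : Set ℂ} (hs : IsOpen s) {C : ℝ}
    (hC : ∀ x ∈ s, ‖u x‖ ≤ C) (hu : ∀ z, DifferentiableOn ℂ (fun x => u x z) s)
    (G : FockSpace d) : DifferentiableOn ℂ (fun x => (inner ℂ G (u x) : ℂ)) s := by
  obtain ⟨g, hg, hlim⟩ := exists_tendstoUniformlyOn_inner u hC G
  refine hlim.tendstoLocallyUniformlyOn.differentiableOn (Eventually.of_forall fun n => ?_) hs
  have hn := hg n
  generalize g n = y at hn
  induction hn using Submodule.span_induction with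
  | mem x hx => obtain ⟨w, rfl⟩ := hx; simpa only [inner_kernel] using hu w
  | zero => simpa only [inner_zero_left] using differentiableOn_const 0
  | add x y _ _ hx hy => simp only [inner_add_left]; exact hx.add hy
  | smul a x _ hx => simpa only [inner_smul_left] using hx.const_mul (conj a)

/-! ### Affine dilations -/

open Classical in
/-- The function `z ↦ exp ((1 - r) z · a) f (r z + (1 - r) s)` if it is in the Fock space. -/
def dilation (a s : Fin d → ℂ) (f : FockSpace d) (r : ℂ) : FockSpace d :=
  if h : ∃ g : FockSpace d, ∀ z, g z = Complex.exp ((1 - r) * (z ⬝ᵥ a)) * f (r • z + (1 - r) • s)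
  then h.choose else 0

lemma dilation_apply_of_exists {a s : Fin d → ℂ} {f : FockSpace d} {r : ℂ} {g : FockSpace d}
    (h : ∀ z, g z = Complex.exp ((1 - r) * (z ⬝ᵥ a)) * f (r • z + (1 - r) • s)) :
    dilation a s f r = g := by
  have h' : ∃ g : FockSpace d,
    ∀ z, g z = Complex.exp ((1 - r) * (z ⬝ᵥ a)) * f (r • z + (1 - r) • s) := ⟨g, h⟩
  rw [dilation, dif_pos h']
  exact FockSpace.ext fun z => by rw [h, h'.choose_spec]

lemma dilation_one (a s : Fin d → ℂ) (f : FockSpace d) : dilation a s f 1 = f :=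
  dilation_apply_of_exists fun z => by simp

lemma exists_dilation_clm (a s : Fin d → ℂ) {ρ : ℝ} (hρ0 : 0 ≤ ρ) (hρ : ρ < 1) :
    ∃ C : ℝ, ∀ r : ℂ, ‖r‖ ≤ ρ → ∃ Y : FockSpace d →L[ℂ] FockSpace d, (∀ f, ‖Y f‖ ≤ C * ‖f‖) ∧
      ∀ f z, Y f z = Complex.exp ((1 - r) * (z ⬝ᵥ a)) * f (r • z + (1 - r) • s) := by
  -- With this choice `ε + (1 + ε)ρ² ≤ 2ε + ρ² = (1 + ρ²)/2 < 1`; the factors `4` in the constant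
  -- come from `|1 - r| ≤ 2`.
  set ε := (1 - ρ ^ 2) / 4 with hε
  have hρ2 : ρ ^ 2 < 1 := by nlinarith
  have hε0 : 0 < ε := by rw [hε]; linarith
  obtain ⟨C, hC⟩ := exists_bounded_weightedComp d (ρ := (1 + ρ ^ 2) / 2) (by linarith)
    (ε⁻¹ * (4 * sqNorm a) + (1 + ε⁻¹) * (4 * sqNorm s))
  refine ⟨C, fun r hr => hC (fun z => Complex.exp ((1 - r) * (z ⬝ᵥ a)))
    (fun z => r • z + (1 - r) • s) ?_ ?_ fun z => ?_⟩
  · unfold dotProduct; fun_prop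
  · fun_prop
  · have h1 := norm_exp_dotProduct_sq_le hε0 z ((1 - r) • a)
    rw [dotProduct_smul, smul_eq_mul] at h1
    have h2 := sqNorm_add_le hε0 (r • z) ((1 - r) • s)
    have hr1 : ‖1 - r‖ ^ 2 ≤ 4 := by
      have : ‖1 - r‖ ≤ 2 := (norm_sub_le _ _).trans (by rw [norm_one]; linarith)
      nlinarith [norm_nonneg (1 - r)]
    have hr2 : ‖r‖ ^ 2 ≤ ρ ^ 2 := by gcongr
    rw [sqNorm_smul] at h1 h2
    rw [sqNorm_smul] at h2
    refine (mul_le_mul h1 (Real.exp_le_exp.2 h2) (Real.exp_pos _).le (Real.exp_pos _).le).trans ?_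
    rw [← Real.exp_add, Real.exp_le_exp]
    have e1 : ε⁻¹ * (‖1 - r‖ ^ 2 * sqNorm a) ≤ ε⁻¹ * (4 * sqNorm a) := by
      have := sqNorm_nonneg a
      gcongr
    have e2 : (1 + ε⁻¹) * (‖1 - r‖ ^ 2 * sqNorm s) ≤ (1 + ε⁻¹) * (4 * sqNorm s) := by
      have := sqNorm_nonneg s
      gcongr
    have e3 : (1 + ε) * (‖r‖ ^ 2 * sqNorm z) ≤ (1 + ε) * (ρ ^ 2 * sqNorm z) := by
      have := sqNorm_nonneg z
      gcongr
    have e4 : ε * sqNorm z + (1 + ε) * (ρ ^ 2 * sqNorm z) ≤ (1 + ρ ^ 2) / 2 * sqNorm z := by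
      have h3 : ε + (1 + ε) * ρ ^ 2 ≤ (1 + ρ ^ 2) / 2 := by nlinarith
      nlinarith [mul_le_mul_of_nonneg_right h3 (sqNorm_nonneg z)]
    linarith

/-- Inside the unit disc the default value `0` in `dilation` is never taken. -/
lemma dilation_apply (a s : Fin d → ℂ) (f : FockSpace d) {r : ℂ} (hr : ‖r‖ < 1)
    (z : Fin d → ℂ) :
    dilation a s f r z = Complex.exp ((1 - r) * (z ⬝ᵥ a)) * f (r • z + (1 - r) • s) := by
  obtain ⟨C, hC⟩ := exists_dilation_clm a s (norm_nonneg r) hr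
  obtain ⟨Y, -, hY⟩ := hC r le_rfl
  rw [dilation_apply_of_exists (hY f), hY]

lemma differentiableOn_inner_dilation (a s : Fin d → ℂ) (f G : FockSpace d) :
    DifferentiableOn ℂ (fun r => (inner ℂ G (dilation a s f r) : ℂ)) (Metric.ball 0 1) := by
  intro r₀ hr₀
  obtain ⟨ρ, h1, h2⟩ := exists_between (mem_ball_zero_iff.1 hr₀)
  obtain ⟨C, hC⟩ := exists_dilation_clm a s ((norm_nonneg r₀).trans h1.le) h2
  have hlt : ∀ r ∈ Metric.ball (0 : ℂ) ρ, ‖r‖ < 1 := fun r hr =>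
    (mem_ball_zero_iff.1 hr).trans h2
  have h3 : DifferentiableOn ℂ (fun r => (inner ℂ G (dilation a s f r) : ℂ))
      (Metric.ball 0 ρ) := by
    refine differentiableOn_inner_of_bounded _ Metric.isOpen_ball (C := C * ‖f‖)
      (fun r hr => ?_) (fun z => ?_) G
    · obtain ⟨Y, hY1, hY2⟩ := hC r (mem_ball_zero_iff.1 hr).le
      rw [dilation_apply_of_exists (hY2 f)]
      exact hY1 f
    · have h4 : Differentiable ℂ fun r : ℂ => f (r • z + (1 - r) • s) :=
        f.differentiable.comp (by fun_prop)
      have h5 : Differentiable ℂ fun r : ℂ =>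
          Complex.exp ((1 - r) * (z ⬝ᵥ a)) * f (r • z + (1 - r) • s) := by fun_prop
      exact h5.differentiableOn.congr fun r hr => dilation_apply a s f (hlt r hr) z
  exact (h3.differentiableAt (Metric.isOpen_ball.mem_nhds
    (mem_ball_zero_iff.2 h1))).differentiableWithinAt

/-- The operator bound of `exists_dilation_clm` is available only for `ρ < 1`, so uniformity up to
`r = 1` needs another argument. For real `r`, convexity of `|·|²` bounds the dilated integrand by
`exp K` times the original one at `r z + (1 - r) s`. The change of variables costs `r⁻ⁿ ≤ 2ⁿ`, with
`n` the real dimension. -/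
lemma exists_norm_dilation_le (a s : Fin d → ℂ) (f : FockSpace d) :
    ∃ C : ℝ, ∀ r ∈ Set.Icc (1 / 2 : ℝ) 1, ‖dilation a s f r‖ ≤ C := by
  set K := sqNorm a + sqNorm s with hK
  have hK0 : 0 ≤ K := add_nonneg (sqNorm_nonneg _) (sqNorm_nonneg _)
  set n := Module.finrank ℝ (Fin d → ℂ)
  refine ⟨√(Real.exp K * (2 ^ n * ‖f‖ ^ 2)), fun r ⟨hr0, hr1⟩ => ?_⟩
  have hrpos : 0 < r := by linarith
  have happ : ∀ z, dilation a s f r z =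
      Complex.exp ((1 - r) * (z ⬝ᵥ a)) * f ((r : ℂ) • z + (1 - r : ℂ) • s) := by
    rcases hr1.lt_or_eq with h | rfl
    · exact dilation_apply a s f (by
        rwa [Complex.norm_real, Real.norm_eq_abs, abs_of_pos hrpos])
    · intro z
      rw [Complex.ofReal_one, dilation_one]
      simp
  set t : Fin d → ℂ := (1 - r : ℂ) • s with ht
  set H : (Fin d → ℂ) → ℝ := fun z => ‖f z‖ ^ 2 * weight z with hH
  have hHi : Integrable H := f.mem.2
  have hHt : Integrable fun z => H (r • z + t) := by
    have := (hHi.comp_add_right t).comp_smul hrpos.ne'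
    exact this
  have hint : ∫ z, H (r • z + t) = |(r ^ n)⁻¹| * ‖f‖ ^ 2 := by
    rw [Measure.integral_comp_smul volume (fun z => H (z + t)) r, integral_add_right_eq_self,
      FockSpace.integral_norm_sq, smul_eq_mul]
  have hexp : ∀ z : Fin d → ℂ, ‖Complex.exp ((1 - r) * (z ⬝ᵥ a))‖ ^ 2 ≤
      Real.exp ((1 - r) * (sqNorm z + sqNorm a)) := by
    intro z
    have h1 := norm_exp_dotProduct_sq_le one_pos z a
    rw [Complex.norm_exp, ← Real.exp_nat_mul, Real.exp_le_exp] at h1 ⊢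
    have h2 : ((1 - r : ℂ) * (z ⬝ᵥ a)).re = (1 - r) * (z ⬝ᵥ a).re := by
      have : (1 - r : ℂ) = ((1 - r : ℝ) : ℂ) := by push_cast; rfl
      rw [this, Complex.re_ofReal_mul]
    rw [h2]
    push_cast at h1 ⊢
    nlinarith [mul_le_mul_of_nonneg_left h1 (sub_nonneg.2 hr1)]
  have hpt : ∀ z, ‖dilation a s f r z‖ ^ 2 * weight z ≤ Real.exp K * H (r • z + t) := by
    intro z
    have hz : (r : ℂ) • z + t = r • z + t := rfl
    rw [happ, norm_mul, mul_pow, hz, hH]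
    have hw : ‖Complex.exp ((1 - r) * (z ⬝ᵥ a))‖ ^ 2 * weight z ≤
        Real.exp K * weight (r • z + t) := by
      have h1 := sqNorm_convex_comb_le hrpos.le hr1 z s
      rw [← ht, hz] at h1
      unfold weight
      calc _ ≤ Real.exp ((1 - r) * (sqNorm z + sqNorm a)) *
              (1 / Real.pi ^ d * Real.exp (-sqNorm z)) := by
            gcongr
            exact hexp z
        _ = 1 / Real.pi ^ d * Real.exp ((1 - r) * (sqNorm z + sqNorm a) + -sqNorm z) := by
            rw [Real.exp_add]; ring
        _ ≤ 1 / Real.pi ^ d * Real.exp (K + -sqNorm (r • z + t)) := by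
            refine mul_le_mul_of_nonneg_left (Real.exp_le_exp.2 ?_) (by positivity)
            nlinarith [mul_nonneg hrpos.le hK0]
        _ = _ := by rw [Real.exp_add]; ring
    calc _ = ‖f (r • z + t)‖ ^ 2 * (‖Complex.exp ((1 - r) * (z ⬝ᵥ a))‖ ^ 2 * weight z) := by ring
      _ ≤ ‖f (r • z + t)‖ ^ 2 * (Real.exp K * weight (r • z + t)) := by gcongr
      _ = _ := by ring
  refine Real.le_sqrt_of_sq_le ?_
  rw [← FockSpace.integral_norm_sq]
  refine (integral_mono (dilation a s f r).mem.2 (hHt.const_mul _) hpt).trans ?_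
  rw [integral_const_mul, hint]
  gcongr
  rw [abs_of_pos (by positivity), ← inv_pow]
  gcongr
  rw [inv_le_comm₀ hrpos two_pos]
  linarith

lemma continuousOn_inner_dilation (a s : Fin d → ℂ) (f G : FockSpace d) :
    ContinuousOn (fun r : ℝ => (inner ℂ G (dilation a s f r) : ℂ)) (Set.Icc (1 / 2) 1) := by
  obtain ⟨C, hC⟩ := exists_norm_dilation_le a s f
  refine continuousOn_inner_of_bounded (fun r : ℝ => dilation a s f r) hC (fun z => ?_) G
  have h4 : Continuous fun r : ℝ => f ((r : ℂ) • z + (1 - r : ℂ) • s) :=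
    f.differentiable.continuous.comp (by fun_prop)
  have h5 : Continuous fun r : ℝ =>
      Complex.exp ((1 - r) * (z ⬝ᵥ a)) * f ((r : ℂ) • z + (1 - r : ℂ) • s) := by fun_prop
  refine h5.continuousOn.congr fun r ⟨hr0, hr1⟩ => ?_
  rcases hr1.lt_or_eq with h | rfl
  · exact dilation_apply a s f (by
      rwa [Complex.norm_real, Real.norm_eq_abs, abs_of_pos (by linarith)]) z
  · simp only [Complex.ofReal_one, dilation_one]
    simp

/-- Analytic continuation from small dilations to the identity. -/
lemma inner_eq_of_dilation_eq {a s a' s' : Fin d → ℂ} {f f' G G' : FockSpace d} {ε : ℝ}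
    (hε : 0 < ε) (h : ∀ r : ℂ, ‖r‖ < ε →
      (inner ℂ G (dilation a s f r) : ℂ) = inner ℂ G' (dilation a' s' f' r)) :
    (inner ℂ G f : ℂ) = inner ℂ G' f' := by
  have h1 := (differentiableOn_inner_dilation a s f G).analyticOnNhd Metric.isOpen_ball
  have h2 := (differentiableOn_inner_dilation a' s' f' G').analyticOnNhd Metric.isOpen_ball
  have h3 := h1.eqOn_of_preconnected_of_eventuallyEq h2
    (convex_ball (0 : ℂ) 1).isPreconnected (Metric.mem_ball_self one_pos) (by
      filter_upwards [Metric.ball_mem_nhds (0 : ℂ) hε] with r hr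
      exact h r (mem_ball_zero_iff.1 hr))
  -- The point `r = 1` is on the boundary of the disc of holomorphy and is reached by continuity
  -- along the real segment.
  have h4 : Set.EqOn (fun r : ℝ => (inner ℂ G (dilation a s f r) : ℂ))
      (fun r : ℝ => inner ℂ G' (dilation a' s' f' r)) (Set.Icc (1 / 2) 1) := by
    refine Set.EqOn.of_subset_closure (s := Set.Ioo (1 / 2) 1) (fun r hr => h3 ?_)
      (continuousOn_inner_dilation a s f G) (continuousOn_inner_dilation a' s' f' G')
      Set.Ioo_subset_Icc_self (by rw [closure_Ioo (by norm_num)])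
    rw [mem_ball_zero_iff, Complex.norm_real, Real.norm_eq_abs, abs_of_pos (by linarith [hr.1])]
    exact hr.2
  have h5 := h4 (Set.right_mem_Icc.2 (by norm_num))
  simpa only [Complex.ofReal_one, dilation_one] using h5

/-! ### Selfadjointness of the maximal operator -/

section Selfadjoint

variable {A Q : Matrix (Fin d) (Fin d) ℂ} {b l q : Fin d → ℂ} {c θ : ℂ}
    {J : FockSpace d →ₗᵢ⋆[ℂ] FockSpace d} {ψ : (Fin d → ℂ) → ℂ} {φ : (Fin d → ℂ) → (Fin d → ℂ)}

open Matrix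

lemma mem_domain_of_apply_eq {f g : FockSpace d} (h : ∀ z, g z = ψ z * f (φ z)) :
    f ∈ (maxWCO ψ φ).domain := by
  change weightedComp ψ φ f ∈ fockSubmodule d
  have : weightedComp ψ φ f = g := funext fun z => (h z).symm
  rw [this]
  exact g.mem

/-- Since the domain is maximal, the graph is exactly the set cut out by the pointwise equations,
and point evaluations are continuous. -/
lemma isClosed_maxWCO : (maxWCO ψ φ).IsClosed := by
  have h : ((maxWCO ψ φ).graph : Set (FockSpace d × FockSpace d)) =
      ⋂ z, {p | inner ℂ (kernel z) p.2 = ψ z * inner ℂ (kernel (φ z)) p.1} := by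
    ext ⟨f, g⟩
    simp only [SetLike.mem_coe, Set.mem_iInter, Set.mem_ofPred_eq, inner_kernel]
    constructor
    · intro h z
      obtain ⟨y, rfl, rfl⟩ := (LinearPMap.mem_graph_iff _).1 h
      rfl
    · intro h
      exact (LinearPMap.mem_graph_iff _).2
        ⟨⟨f, mem_domain_of_apply_eq h⟩, rfl, FockSpace.ext fun z => (h z).symm⟩
  rw [LinearPMap.IsClosed, h]
  refine isClosed_iInter fun z => isClosed_eq ?_ ?_ <;> fun_prop

lemma dense_domain_maxWCO (hker : ∀ w, kernel w ∈ (maxWCO ψ φ).domain) :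
    Dense ((maxWCO ψ φ).domain : Set (FockSpace d)) := by
  refine dense_span_kernel.mono (Submodule.span_le.2 ?_)
  rintro _ ⟨w, rfl⟩
  exact hker w

/-- The action of a weighted composition operator with complex symmetric symbols on the images of
the kernel functions under the conjugation. -/
lemma symbol_mul_map_kernel (hJ : IsConjugation J) (hJform : IsWeightedConj A b c J)
    (hAQ : (A * Q)ᵀ = A * Q) (hl : l = star (A *ᵥ q) + star b - Qᴴ *ᵥ star b)
    (z u : Fin d → ℂ) :
    θ * Complex.exp (herm u l) * J (kernel z) (Q *ᵥ u + q) =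
      θ * Complex.exp (herm z l) * J (kernel (Q *ᵥ z + q)) u := by
  have hA := hJform.transpose_eq hJ
  have hherm : ∀ x, herm x l = A *ᵥ q ⬝ᵥ x + b ⬝ᵥ x - b ⬝ᵥ Q *ᵥ x := by
    intro x
    rw [herm_eq_dotProduct, hl, star_sub, star_add, star_star, star_star, star_mulVec, star_star,
      conjTranspose_conjTranspose, dotProduct_comm, sub_dotProduct, add_dotProduct,
      ← dotProduct_mulVec]
  rw [hJform.kernel_apply, hJform.kernel_apply, hherm, hherm]
  have hsym : A *ᵥ Q *ᵥ u ⬝ᵥ z = A *ᵥ u ⬝ᵥ Q *ᵥ z := by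
    rw [mulVec_mulVec, mulVec_dotProduct_comm hAQ, ← mulVec_mulVec, mulVec_dotProduct_comm hA]
  have e : (A *ᵥ q ⬝ᵥ u + b ⬝ᵥ u - b ⬝ᵥ Q *ᵥ u) +
      ((Q *ᵥ u + q) ⬝ᵥ b + (A *ᵥ (Q *ᵥ u + q) + b) ⬝ᵥ z) =
      (A *ᵥ q ⬝ᵥ z + b ⬝ᵥ z - b ⬝ᵥ Q *ᵥ z) +
      (u ⬝ᵥ b + (A *ᵥ u + b) ⬝ᵥ (Q *ᵥ z + q)) := by
    simp only [mulVec_add, add_dotProduct, dotProduct_add, hsym, mulVec_dotProduct_comm hA u q,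
      dotProduct_comm _ b]
    ring
  have e' := congrArg Complex.exp e
  rw [Complex.exp_add, Complex.exp_add (_ - _)] at e'
  linear_combination θ * c * e'

/-- The adjoint, transported by the conjugation, is a restriction of the maximal operator. -/
lemma conjOp_adjoint_le (hJ : IsConjugation J)
    (hker : ∀ w, kernel w ∈ (maxWCO ψ φ).domain)
    (hsymb : ∀ z u, ψ u * J (kernel z) (φ u) = ψ z * J (kernel (φ z)) u) :
    conjOp J (maxWCO ψ φ).adjoint ≤ maxWCO ψ φ := by
  -- `S` maps `J K_z` to `ψ(z) J K_{φ(z)}`, so pairing `S* J f` with `J K_z` reads off the value of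
  -- `J S* J f` at `z`.
  have key : ∀ f : (conjOp J (maxWCO ψ φ).adjoint).domain, ∀ z,
      conjOp J (maxWCO ψ φ).adjoint f z = ψ z * (f : FockSpace d) (φ z) := by
    intro f z
    have hz : ∀ u, (ψ z • J (kernel (φ z))) u = ψ u * J (kernel z) (φ u) := fun u =>
      (hsymb z u).symm
    have h1 : maxWCO ψ φ ⟨J (kernel z), mem_domain_of_apply_eq hz⟩ = ψ z • J (kernel (φ z)) :=
      FockSpace.ext fun u => (hz u).symm
    have h2 := LinearPMap.adjoint_isFormalAdjoint (dense_domain_maxWCO hker) ⟨J f, f.2⟩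
      ⟨J (kernel z), mem_domain_of_apply_eq hz⟩
    rw [h1, inner_smul_right, inner_map_map_conj, inner_kernel] at h2
    rw [← h2, ← inner_kernel]
    change inner ℂ (kernel z) (J _) = _
    rw [← inner_map_map_conj J, hJ]
  refine ⟨fun f hf => mem_domain_of_apply_eq (key ⟨f, hf⟩), fun f g hfg => ?_⟩
  refine FockSpace.ext fun z => ?_
  rw [key, maxWCO_apply, hfg]

lemma le_conjOp_adjoint {H : Type*} [NormedAddCommGroup H] [InnerProductSpace ℂ H]
    [CompleteSpace H] {J : H →ₗᵢ⋆[ℂ] H} (hJ : IsConjugation J) {S : H →ₗ.[ℂ] H}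
    (hd : Dense (S.domain : Set H))
    (h : ∀ f g : S.domain, inner ℂ (J g) (S f) = inner ℂ (J f) (S g)) :
    S ≤ conjOp J S.adjoint := by
  have h1 : ∀ f g : S.domain, inner ℂ (J (S f)) (g : H) = inner ℂ (J f) (S g) := fun f g => by
    rw [hJ.inner_comm, h]
  refine ⟨fun f hf => LinearPMap.mem_adjoint_domain_of_exists _ ⟨J (S ⟨f, hf⟩), h1 ⟨f, hf⟩⟩,
    fun f g hfg => ?_⟩
  have h2 : S.adjoint ⟨J g, g.2⟩ = J (S f) := LinearPMap.adjoint_apply_eq hd _ fun x => by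
    rw [h1]
    simp only [hfg]
  change _ = J (S.adjoint ⟨J g, g.2⟩)
  rw [h2, hJ]

/-- The symmetry relation when one of the functions is a kernel function. -/
lemma inner_map_maxWCO_kernel (hJ : IsConjugation J)
    (hJform : IsWeightedConj A b c J) (hker : ∀ w, kernel w ∈ (maxWCO ψ φ).domain)
    (hsymb : ∀ z u, ψ u * J (kernel z) (φ u) = ψ z * J (kernel (φ z)) u)
    (w : Fin d → ℂ) (g : (maxWCO ψ φ).domain) :
    inner ℂ (J g) (maxWCO ψ φ ⟨kernel w, hker w⟩) =
      inner ℂ (J (maxWCO ψ φ g)) (kernel w) := by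
  set α := c * Complex.exp (b ⬝ᵥ w) with hα
  set x := star (A *ᵥ w + b) with hx
  have h1 : J (kernel w) = α • kernel x := hJform.map_kernel hJ w
  have h2 : kernel w = conj α • J (kernel x) := by
    rw [← J.map_smulₛₗ, ← h1, hJ]
  have h3 : maxWCO ψ φ ⟨kernel w, hker w⟩ = (conj α * ψ x) • J (kernel (φ x)) := by
    refine FockSpace.ext fun u => ?_
    rw [maxWCO_apply, FockSpace.smul_apply, mul_assoc, ← hsymb]
    change ψ u * kernel w (φ u) = _
    rw [h2, FockSpace.smul_apply]
    ring
  rw [h3, inner_smul_right, inner_map_map_conj, inner_kernel, hJ.inner_comm, h1, inner_smul_left,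
    inner_kernel, maxWCO_apply]
  ring

/-- With the right side rewritten as `⟨J S g, f⟩`, both sides are limits of pairings of dilations,
which agree for small `r` by boundedness and density of kernels. -/
lemma inner_map_maxWCO_comm (hJ : IsConjugation J) (hJform : IsWeightedConj A b c J)
    (hker : ∀ w, kernel w ∈ (maxWCO ψ φ).domain)
    (hsymb : ∀ z u, ψ u * J (kernel z) (φ u) = ψ z * J (kernel (φ z)) u)
    (hψ : ψ = fun z => θ * Complex.exp (herm z l)) (hφ : φ = fun z => Q *ᵥ z + q)
    (f g : (maxWCO ψ φ).domain) :
    inner ℂ (J g) (maxWCO ψ φ f) = inner ℂ (J f) (maxWCO ψ φ g) := by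
  rw [hJ.inner_comm (f : FockSpace d)]
  obtain ⟨K, hK0, hK⟩ := exists_sqNorm_mulVec_le Q
  -- Young's inequality with parameter `1/4`, used twice together with `|r|² |Q z|² ≤ |z|²/4`, gives
  -- `1/4 + (5/4)(1/4) = 9/16`, with constants `4` and `1 + 4`. The choice of `ε` below ensures that
  -- bound.
  obtain ⟨CY, hCY⟩ := exists_bounded_weightedComp d (ρ := 9 / 16) (by norm_num)
    (‖θ‖ ^ 2 + 4 * sqNorm (star l) + 5 * sqNorm q)
  obtain ⟨CT, hCT⟩ := exists_dilation_clm (0 : Fin d → ℂ) q (ρ := 1 / 2) (by norm_num) (by norm_num)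
  set ε : ℝ := (2 * (1 + K))⁻¹ with hε
  have hε0 : 0 < ε := by positivity
  have hε1 : ε ≤ 1 / 2 := by
    rw [hε, inv_le_comm₀ (by positivity) (by norm_num)]; linarith
  have hε2 : ε ^ 2 * K ≤ 1 / 4 := by
    have : ε * (1 + K) = 1 / 2 := by rw [hε]; field_simp
    nlinarith
  -- The factor `exp ((1 - r) z·star l)` restores the full weight `ψ z` from `ψ (r z)`, and `Q(rz) +
  -- q = r φ(z) + (1 - r) q`. This is why `S f` is dilated about `0` and `f` about `q`.
  refine inner_eq_of_dilation_eq (a := star l) (s := 0) (a' := 0) (s' := q) hε0 fun r hr => ?_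
  obtain ⟨T, -, hT⟩ := hCT r (hr.le.trans hε1)
  have hrK : ‖r‖ ^ 2 * K ≤ 1 / 4 := (mul_le_mul_of_nonneg_right
    (pow_le_pow_left₀ (norm_nonneg r) hr.le 2) hK0).trans hε2
  obtain ⟨Y, -, hY⟩ := hCY (fun z => θ * Complex.exp (z ⬝ᵥ star l)) (fun z => r • (Q *ᵥ z) + q)
    (by unfold dotProduct; fun_prop)
    ((((Q.mulVecLin.toContinuousLinearMap).differentiable).const_smul r).add_const q) (by
      intro z
      have h1 := norm_exp_dotProduct_sq_le (ε := 1 / 4) (by norm_num) z (star l)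
      have h2 := sqNorm_add_le (ε := 1 / 4) (by norm_num) (r • (Q *ᵥ z)) q
      rw [sqNorm_smul] at h2
      have h3 : ‖r‖ ^ 2 * sqNorm (Q *ᵥ z) ≤ 1 / 4 * sqNorm z := by
        calc ‖r‖ ^ 2 * sqNorm (Q *ᵥ z) ≤ ‖r‖ ^ 2 * (K * sqNorm z) := by gcongr; exact hK z
          _ = (‖r‖ ^ 2 * K) * sqNorm z := by ring
          _ ≤ _ := mul_le_mul_of_nonneg_right hrK (sqNorm_nonneg z)
      have h4 : ‖θ‖ ^ 2 ≤ Real.exp (‖θ‖ ^ 2) := by linarith [Real.add_one_le_exp (‖θ‖ ^ 2)]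
      rw [norm_mul, mul_pow]
      refine (mul_le_mul (mul_le_mul h4 h1 (by positivity) (Real.exp_pos _).le)
        (Real.exp_le_exp.2 h2) (Real.exp_pos _).le (by positivity)).trans ?_
      rw [← Real.exp_add, ← Real.exp_add, Real.exp_le_exp]
      norm_num
      linarith)
  have hψz : ∀ z, ψ z = θ * Complex.exp (z ⬝ᵥ star l) := fun z => congrFun hψ z
  have hφz : ∀ z, φ z = Q *ᵥ z + q := fun z => congrFun hφ z
  have hYT : ∀ (f : FockSpace d) z, Y f z = ψ z * T f (φ z) := by
    intro f z
    rw [hY, hT, hψz, hφz, dotProduct_zero, mul_zero, Complex.exp_zero, one_mul]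
    congr 2
    rw [smul_add, add_assoc, ← add_smul, add_sub_cancel, one_smul]
  have hlhs : dilation (star l) 0 (maxWCO ψ φ f) r = Y f := by
    refine dilation_apply_of_exists fun z => ?_
    have h1 : Q *ᵥ (r • z + (1 - r) • 0) + q = r • (Q *ᵥ z) + q := by simp [mulVec_smul]
    have h2 : Complex.exp (z ⬝ᵥ star l) = Complex.exp ((1 - r) * (z ⬝ᵥ star l)) *
        Complex.exp ((r • z + (1 - r) • 0) ⬝ᵥ star l) := by
      rw [← Complex.exp_add, smul_zero, add_zero, smul_dotProduct, smul_eq_mul]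
      congr 1
      ring
    rw [maxWCO_apply, hY, hψz, hφz, h1, h2]
    ring
  rw [hlhs, dilation_apply_of_exists (hT f)]
  -- Both sides are bounded functionals, so kernels suffice. `T` sends a kernel to a multiple of a
  -- kernel, for which the symmetry with `g` is already known.
  have hclm : (innerSL ℂ (J g)).comp Y = (innerSL ℂ (J (maxWCO ψ φ g))).comp T := by
    refine ContinuousLinearMap.ext_on dense_span_kernel ?_
    rintro _ ⟨w, rfl⟩
    have hTw : T (kernel w) = Complex.exp ((1 - r) * (q ⬝ᵥ star w)) • kernel (star r • w) := by
      refine FockSpace.ext fun z => ?_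
      rw [hT, FockSpace.smul_apply, kernel_apply, kernel_apply, dotProduct_zero, mul_zero,
        Complex.exp_zero, one_mul, ← Complex.exp_add]
      congr 1
      simp only [add_dotProduct, smul_dotProduct, star_smul, star_star, dotProduct_smul,
        smul_eq_mul]
      ring
    have hYw : Y (kernel w) = Complex.exp ((1 - r) * (q ⬝ᵥ star w)) •
        maxWCO ψ φ ⟨kernel (star r • w), hker _⟩ := by
      refine FockSpace.ext fun z => ?_
      rw [hYT, hTw, FockSpace.smul_apply, FockSpace.smul_apply, maxWCO_apply]
      ring
    simp only [ContinuousLinearMap.comp_apply, innerSL_apply_apply]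
    rw [hTw, hYw, inner_smul_right, inner_smul_right,
      inner_map_maxWCO_kernel hJ hJform hker hsymb]
  exact DFunLike.congr_fun hclm (f : FockSpace d)

lemma isCSelfadjoint_maxWCO (hJ : IsConjugation J) (hJform : IsWeightedConj A b c J)
    (hker : ∀ w, kernel w ∈ (maxWCO ψ φ).domain)
    (hψ : ψ = fun z => θ * Complex.exp (herm z l)) (hφ : φ = fun z => Q *ᵥ z + q)
    (hAQ : (A * Q)ᵀ = A * Q) (hl : l = star (A *ᵥ q) + star b - Qᴴ *ᵥ star b) :
    IsCSelfadjoint J (maxWCO ψ φ) := by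
  have hsymb : ∀ z u, ψ u * J (kernel z) (φ u) = ψ z * J (kernel (φ z)) u := fun z u => by
    simpa only [hψ, hφ] using symbol_mul_map_kernel (θ := θ) hJ hJform hAQ hl z u
  have hd := dense_domain_maxWCO hker
  exact ⟨isClosed_maxWCO, hd, le_antisymm
    (le_conjOp_adjoint hJ hd (inner_map_maxWCO_comm hJ hJform hker hsymb hψ hφ))
    (conjOp_adjoint_le hJ hker hsymb)⟩

end Selfadjoint

end Fock

end

theorem corollary2p7 {d : ℕ} (A : Matrix (Fin d) (Fin d) ℂ) (b : Fin d → ℂ) (c : ℂ)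
    (J : Fock.FockSpace d →ₗᵢ⋆[ℂ] Fock.FockSpace d) (hJ : Fock.IsConjugation J)
    (hJform : Fock.IsWeightedConj A b c J)
    (ψ : (Fin d → ℂ) → ℂ) (φ : (Fin d → ℂ) → (Fin d → ℂ))
    (hψ : Differentiable ℂ ψ) (hψ0 : ψ ≠ 0) (hφ : Differentiable ℂ φ)
    (hker : ∀ w : Fin d → ℂ, Fock.kernel w ∈ (Fock.maxWCO ψ φ).domain) :
    List.TFAE [
      Fock.IsCSelfadjoint J (Fock.maxWCO ψ φ),
      Fock.IsCSymmetric J (Fock.maxWCO ψ φ),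
      ∃ (θ : ℂ) (l q : Fin d → ℂ) (Q : Matrix (Fin d) (Fin d) ℂ),
        ψ = (fun z => θ * Complex.exp (Fock.herm z l)) ∧
        φ = (fun z => Q.mulVec z + q) ∧
        (A * Q).transpose = A * Q ∧
        l = star (A.mulVec q) + star b - Q.conjTranspose.mulVec (star b)] := by
  tfae_have 1 → 2 := fun ⟨hc, hd, h⟩ => ⟨hc, hd, h.le⟩
  tfae_have 2 → 3 := fun h => h.exists_symbols hJ hJform hψ0 hφ hker
  tfae_have 3 → 1 := fun ⟨_, _, _, _, hψe, hφe, hAQ, hl⟩ =>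
    Fock.isCSelfadjoint_maxWCO hJ hJform hker hψe hφe hAQ hl
  tfae_finish
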